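/- Let $\mathfrak g$ be a finite-dimensional real reductive Lie algebra with a Cartan involution $\theta$; that is, $\theta$ is an automorphism of $\mathfrak g$ with $\theta^2=\mathrm{id}$, and there is a $\theta$-invariant symmetric bilinear form $B$ on $\mathfrak g$ with $B([x,y],z)=B(x,[y,z])$ such that $(x,y)\mapsto -B(x,\theta y)$ is positive definite. (For instance, $\mathfrak g$ is the Lie algebra of the identity component $G$ of $\underline{G}(\mathbb R)$ for a connected reductive algebraic group $\underline G$ defined over $\mathbb R$, and $\theta$ is the differential of a Cartan involution of $G$.) Let $\mathfrak k=\{x\in\mathfrak g:\theta x=x\}$ and $\mathfrak g_{\mathbb C}=\mathfrak g\otimes_{\mathbb R}\mathbb C$. For a finite-dimensional real or complex Lie algebra $\mathfrak l$ let $\mathrm{Int}(\mathfrak l)$ be the group generated by all $e^{\operatorname{ad}x}$, $x\in\mathfrak l$; its elements are the inner automorphisms of $\mathfrak l$. Then the complex-linear extension of $\theta$ to $\mathfrak g_{\mathbb C}$ is an inner automorphism of $\mathfrak g_{\mathbb C}$ if and only if $\mathfrak k$ is a subalgebra of maximal rank of $\mathfrak g$, i.e. $\operatorname{rank}\mathfrak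 k=\operatorname{rank}\mathfrak g$. In that case $\mathfrak g$ admits a compact Cartan subalgebra, i.e. a Cartan subalgebra $\mathfrak h$ of $\mathfrak g$ such that $\varphi(\mathfrak h)\subseteq\mathfrak k$ for some $\varphi\in\mathrm{Int}(\mathfrak g)$. -/

import Mathlib

open scoped TensorProduct

noncomputable section

namespace ReductiveLie

/-- The exponential of an endomorphism `T` of a finite-dimensional real or complex vector space,
computed in coordinates with Mathlib's matrix exponential. It does not depend on the basis, see
`toMatrix_expEnd`. -/
def expEnd (𝕜 : Type*) {V : Type*} [RCLike 𝕜] [AddCommGroup V] [Module 𝕜 V]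
    [FiniteDimensional 𝕜 V] (T : V →ₗ[𝕜] V) : V →ₗ[𝕜] V :=
  Matrix.toLin (Module.finBasis 𝕜 V) (Module.finBasis 𝕜 V)
    (NormedSpace.exp (LinearMap.toMatrix (Module.finBasis 𝕜 V) (Module.finBasis 𝕜 V) T))

section exp

variable {𝕜 V : Type*} [RCLike 𝕜] [AddCommGroup V] [Module 𝕜 V] [FiniteDimensional 𝕜 V]

/-- In every basis, the matrix of `expEnd 𝕜 T` is the exponential of the matrix of `T`. -/
theorem toMatrix_expEnd {n : ℕ} (b : Module.Basis (Fin n) 𝕜 V) (T : V →ₗ[𝕜] V) :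
    LinearMap.toMatrix b b (expEnd 𝕜 T) = NormedSpace.exp (LinearMap.toMatrix b b T) := by
  obtain rfl : n = Module.finrank 𝕜 V := by
    simpa using (Module.finrank_eq_card_basis b).symm
  set c := Module.finBasis 𝕜 V with hc
  have h1 : b.toMatrix c * c.toMatrix b = 1 := b.toMatrix_mul_toMatrix_flip c
  have h2 : (b.toMatrix c)⁻¹ = c.toMatrix b := Matrix.inv_eq_right_inv h1
  have hu : IsUnit (b.toMatrix c) := IsUnit.of_mul_eq_one _ h1
  have key : ∀ S : V →ₗ[𝕜] V, LinearMap.toMatrix b b S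
      = b.toMatrix c * LinearMap.toMatrix c c S * (b.toMatrix c)⁻¹ := fun S => by
    rw [h2, basis_toMatrix_mul_linearMap_toMatrix_mul_basis_toMatrix]
  rw [key, key T, Matrix.exp_conj _ _ hu, expEnd, LinearMap.toMatrix_toLin]

/-- The exponential of an endomorphism is invertible. -/
theorem exists_linearEquiv_eq_expEnd (T : V →ₗ[𝕜] V) :
    ∃ φ : V ≃ₗ[𝕜] V, (φ : V →ₗ[𝕜] V) = expEnd 𝕜 T := by
  have hu : IsUnit (expEnd 𝕜 T) := by
    have h := (Matrix.isUnit_exp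
      (LinearMap.toMatrix (Module.finBasis 𝕜 V) (Module.finBasis 𝕜 V) T)).map
      (Matrix.toLinAlgEquiv (Module.finBasis 𝕜 V))
    exact h
  exact ⟨LinearMap.GeneralLinearGroup.toLinearEquiv hu.unit, rfl⟩

end exp

/-- `Int(L)`: the group of inner automorphisms of a finite-dimensional real or complex Lie algebra
`L`, that is, the subgroup of `GL(L)` generated by all `exp (ad x)`, `x ∈ L`. -/
def innerAutomorphisms (𝕜 L : Type*) [RCLike 𝕜] [LieRing L] [LieAlgebra 𝕜 L]
    [FiniteDimensional 𝕜 L] : Subgroup (L ≃ₗ[𝕜] L) :=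
  Subgroup.closure {φ | ∃ x : L, (φ : L →ₗ[𝕜] L) = expEnd 𝕜 (LieAlgebra.ad 𝕜 L x)}

section real

variable {L : Type*} [LieRing L] [LieAlgebra ℝ L]

/-- `θ` is a Cartan involution of the real Lie algebra `L`: it is an involutive automorphism, and
there is an invariant, `θ`-invariant symmetric bilinear form `B` on `L` such that
`(x, y) ↦ -B (x, θ y)` is positive definite. A finite-dimensional real Lie algebra has a Cartan
involution exactly when it is reductive; on a semisimple one, `B` can be taken to be the Killing
form. -/
structure IsCartanInvolution (θ : L ≃ₗ⁅ℝ⁆ L) : Prop where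
  involutive : ∀ x, θ (θ x) = x
  exists_form : ∃ B : LinearMap.BilinForm ℝ L,
    (∀ x y, B x y = B y x) ∧
    (∀ x y z, B ⁅x, y⁆ z = B x ⁅y, z⁆) ∧
    (∀ x y, B (θ x) (θ y) = B x y) ∧
    (∀ x, x ≠ 0 → 0 < -B x (θ x))

/-- The subalgebra `𝔨` of fixed points of `θ`. -/
def fixedSubalgebra (θ : L ≃ₗ⁅ℝ⁆ L) : LieSubalgebra ℝ L where
  carrier := {x | θ x = x}
  add_mem' {x y} hx hy := by
    change θ x = x at hx
    change θ y = y at hy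
    change θ (x + y) = x + y
    rw [map_add, hx, hy]
  zero_mem' := map_zero θ
  smul_mem' c x hx := by
    change θ x = x at hx
    change θ (c • x) = c • x
    rw [map_smul, hx]
  lie_mem' {x y} hx hy := by
    change θ x = x at hx
    change θ y = y at hy
    change θ ⁅x, y⁆ = ⁅x, y⁆
    rw [LieEquiv.map_lie, hx, hy]

variable [FiniteDimensional ℝ L]

/-- The complex-linear extension of `θ` to the complexification of `L` is an inner
automorphism. -/
def IsInnerOnComplexification (θ : L ≃ₗ⁅ℝ⁆ L) : Prop :=
  θ.toLinearEquiv.baseChange ℝ ℂ L L ∈ innerAutomorphisms ℂ (ℂ ⊗[ℝ] L)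

/-- A subalgebra has maximal rank if its rank is that of the whole Lie algebra. -/
def HasMaximalRank (k : LieSubalgebra ℝ L) : Prop :=
  LieAlgebra.rank ℝ k = LieAlgebra.rank ℝ L

/-- A compact Cartan subalgebra of the reductive Lie algebra `L` with Cartan involution `θ`: a
Cartan subalgebra `h` that some inner automorphism of `L` moves into the maximal compact
subalgebra `𝔨 = L^θ`. (If `L` is the Lie algebra of a connected real reductive group `G`, with
`θ` coming from a Cartan involution of `G` and maximal compact subgroup `K = G^θ`, then `Int(L)` is
`Ad(G)`, every compact subgroup of `G` is conjugate to a subgroup of `K`, and so this says that the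
connected subgroup of `G` with Lie algebra `h` is compact.) -/
def IsCompactCartanSubalgebra (θ : L ≃ₗ⁅ℝ⁆ L) (h : LieSubalgebra ℝ L) : Prop :=
  h.IsCartanSubalgebra ∧
    ∃ φ ∈ innerAutomorphisms ℝ L, ∀ x ∈ h, φ x ∈ fixedSubalgebra θ

end real

end ReductiveLie

end

/-!
Write `𝔨` for the fixed points of `θ`. A Cartan involution provides an inner product `S` on `L` for
which the adjoint of `ad x` is `-ad (θ x)`. Choose `X` in `𝔨` whose centralizer `𝔥` in `L` has the
smallest possible dimension. Perturbing `X` shows that `𝔥 ∩ 𝔨` acts trivially on `𝔥`, and positivity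
of `S` then makes `𝔥` abelian (`IsCartanForm.exists_abelian_centralizer`). As `ad X` is
semisimple, `(x, h) ↦ exp (ad x) h` is a submersion `L × 𝔥 → L` at `(0, X)`, so elements near `X`
are conjugate into `𝔥`; by analyticity `dim 𝔥` bounds the dimensions of all Engel subalgebras from
below (`finrank_ker_ad_le_finrank_maxGenEigenspace`), whence `rank L = dim 𝔥`. The same argument in
`𝔨` gives `rank 𝔨 = dim (𝔥 ∩ 𝔨)`. So the rank of `𝔨` is maximal exactly if `𝔥 ⊆ 𝔨`
(`IsCartanForm.hasMaximalRank_iff`), and then `𝔥` is a Cartan subalgebra contained in `𝔨`.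

If `θ` is inner on the complexification, so is `θ exp (s ad X)`. For every inner automorphism `g`,
the eigenvalue `1` has multiplicity at least `dim 𝔥`
(`le_finrank_maxGenEigenspace_sub_one_of_mem_innerAutomorphisms`): an automorphism near the identity
which is trivial on the centre is the exponential of a small derivation, this derivation is inner,
and the bound extends along an analytic path from the identity to `g`. For small `s ≠ 0`, the
generalized eigenspace of `θ exp (s ad X)` for the eigenvalue `1` is contained in `𝔥 ∩ 𝔨`, so
`𝔥 ⊆ 𝔨`.

Conversely, let `𝔥 ⊆ 𝔨`. Then `θ` fixes `𝔥` and preserves the root spaces of `𝔥` in the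
complexification. The identity `|[x, y]|² = |[σ x, y]|² - |x|² |y|² (α, β)` for root vectors `x`,
`y` (`IsTorusFixedBy.inner_lie_self`) shows that root spaces are one-dimensional and that
`[x, y] ≠ 0` if `(α, β) < 0`. Hence `θ` acts by a sign on each root space, multiplicatively along
obtuse pairs of roots. The simple roots of a positive system are linearly independent, so such a
sign is of the form `exp (π i f(α))` for a linear functional `f` (`exists_dual_exp_eq`), and `θ` is
the exponential of the element of the torus representing `π f`.
-/

noncomputable section

open scoped Topology
open Module

namespace ReductiveLie

/-! ### Exponentials of endomorphisms -/

section Normed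

variable {𝕜 V : Type*} [RCLike 𝕜] [NormedAddCommGroup V] [NormedSpace 𝕜 V] [FiniteDimensional 𝕜 V]

open scoped Matrix.Norms.Operator in
/-- The exponential `expEnd`, defined through matrices, is that of the Banach algebra of bounded
operators for every choice of a norm. -/
theorem expEnd_eq_exp (T : V →L[𝕜] V) :
    expEnd 𝕜 (T : V →ₗ[𝕜] V) = (NormedSpace.exp T : V →L[𝕜] V) := by
  have : CompleteSpace V := FiniteDimensional.complete 𝕜 V
  let : NormedAlgebra ℚ (V →L[𝕜] V) := NormedAlgebra.restrictScalars ℚ 𝕜 _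
  let b := finBasis 𝕜 V
  let f : (V →L[𝕜] V) →+* Matrix (Fin (finrank 𝕜 V)) (Fin (finrank 𝕜 V)) 𝕜 :=
    ((LinearMap.toMatrixAlgEquiv b : (V →ₗ[𝕜] V) ≃ₐ[𝕜] _) : (V →ₗ[𝕜] V) →+* _).comp
      ContinuousLinearMap.toLinearMapRingHom
  have hf : Continuous f := by
    let g : (V →L[𝕜] V) →ₗ[𝕜] Matrix (Fin (finrank 𝕜 V)) (Fin (finrank 𝕜 V)) 𝕜 :=
      (LinearMap.toMatrix b b).toLinearMap ∘ₗ ContinuousLinearMap.coeLM 𝕜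
    exact g.continuous_of_finiteDimensional
  have h := NormedSpace.map_exp f hf T
  rw [expEnd]
  apply (LinearMap.toMatrix b b).injective
  rw [LinearMap.toMatrix_toLin]
  exact h.symm

theorem expEnd_apply_eq_exp (T : V →L[𝕜] V) (v : V) :
    expEnd 𝕜 (T : V →ₗ[𝕜] V) v = (NormedSpace.exp T : V →L[𝕜] V) v := by
  rw [expEnd_eq_exp]; rfl

theorem hasDerivAt_exp_smul_apply (T : V →L[𝕜] V) (v : V) (s : 𝕜) :
    HasDerivAt (fun s : 𝕜 => (NormedSpace.exp (s • T) : V →L[𝕜] V) v)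
      ((NormedSpace.exp (s • T) : V →L[𝕜] V) (T v)) s := by
  have : CompleteSpace V := FiniteDimensional.complete 𝕜 V
  exact (hasDerivAt_exp_smul_const T s).clm_apply (hasDerivAt_const s v) |>.congr_deriv (by simp)

/-- Near the origin, exponentials `exp (s T)`, `0 ≤ s ≤ 1`, are uniformly close to the identity. -/
theorem exists_norm_exp_smul_sub_one_lt (𝕜 V : Type*) [RCLike 𝕜] [NormedAddCommGroup V]
    [NormedSpace 𝕜 V] [FiniteDimensional 𝕜 V] {ε : ℝ} (hε : 0 < ε) :
    ∃ δ > 0, ∀ T : V →L[𝕜] V, ‖T‖ < δ → ∀ s : 𝕜, ‖s‖ ≤ 1 →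
      ‖(NormedSpace.exp (s • T) : V →L[𝕜] V) - 1‖ < ε := by
  have : CompleteSpace V := FiniteDimensional.complete 𝕜 V
  let : NormedAlgebra ℚ (V →L[𝕜] V) := NormedAlgebra.restrictScalars ℚ 𝕜 _
  have hc : ContinuousAt (NormedSpace.exp : (V →L[𝕜] V) → (V →L[𝕜] V)) 0 :=
    NormedSpace.exp_continuous.continuousAt
  obtain ⟨δ, hδ, h⟩ := Metric.continuousAt_iff.1 hc ε hε
  refine ⟨δ, hδ, fun T hT s hs => ?_⟩
  have h1 : dist (s • T) 0 < δ := by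
    rw [dist_zero_right, norm_smul]
    exact (mul_le_of_le_one_left (norm_nonneg _) hs).trans_lt hT
  simpa [dist_eq_norm] using h h1

/-- For a small operator `T`, a vector fixed by `exp T` is killed by `T`. -/
theorem exists_apply_eq_zero_of_exp_apply_eq (𝕜 V : Type*) [RCLike 𝕜] [NormedAddCommGroup V]
    [NormedSpace 𝕜 V] [FiniteDimensional 𝕜 V] :
    ∃ δ > 0, ∀ T : V →L[𝕜] V, ‖T‖ < δ → ∀ v : V,
      (NormedSpace.exp T : V →L[𝕜] V) v = v → T v = 0 := by
  obtain ⟨δ, hδ, h⟩ := exists_norm_exp_smul_sub_one_lt 𝕜 V (ε := 1 / 2) (by norm_num)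
  refine ⟨δ, hδ, fun T hT v hv => ?_⟩
  let : NormedSpace ℝ V := NormedSpace.restrictScalars ℝ 𝕜 V
  -- `exp (s T) v - s T v` has derivative `(exp (s T) - 1) (T v)`, which is small against `T v`.
  have hd : ∀ s ∈ Set.Icc (0 : ℝ) 1, HasDerivWithinAt
      (fun s : ℝ => (NormedSpace.exp ((s : 𝕜) • T) : V →L[𝕜] V) v - (s : ℝ) • T v)
      (((NormedSpace.exp ((s : 𝕜) • T) : V →L[𝕜] V) - 1) (T v)) (Set.Icc 0 1) s := by
    intro s _
    have h1 : HasDerivAt (fun s : ℝ => (NormedSpace.exp ((s : 𝕜) • T) : V →L[𝕜] V) v)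
        ((NormedSpace.exp ((s : 𝕜) • T) : V →L[𝕜] V) (T v)) s := by
      have hr : HasDerivAt (fun r : ℝ => (r : 𝕜)) 1 s := by
        simpa using (RCLike.ofRealCLM (K := 𝕜)).hasDerivAt (x := s)
      simpa using! (hasDerivAt_exp_smul_apply T v (s : 𝕜)).scomp s hr
    have h2 := (hasDerivAt_id s).smul_const (T v)
    exact ((h1.sub h2).congr_deriv (by simp)).hasDerivWithinAt
  have hb := norm_image_sub_le_of_norm_deriv_le_segment_01' hd (C := 1 / 2 * ‖T v‖) (by
    intro s hs
    refine (ContinuousLinearMap.le_opNorm _ _).trans ?_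
    gcongr
    refine (h T hT s ?_).le
    rw [RCLike.norm_ofReal, abs_of_nonneg hs.1]; exact hs.2.le)
  simp [hv] at hb
  have : ‖T v‖ ≤ 0 := by linarith
  simpa using this

/-- The exponential of a small operator does not have the eigenvalue `-1`. -/
theorem exists_eq_zero_of_exp_apply_eq_neg (𝕜 V : Type*) [RCLike 𝕜] [NormedAddCommGroup V]
    [NormedSpace 𝕜 V] [FiniteDimensional 𝕜 V] :
    ∃ δ > 0, ∀ T : V →L[𝕜] V, ‖T‖ < δ → ∀ v : V,
      (NormedSpace.exp T : V →L[𝕜] V) v = -v → v = 0 := by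
  obtain ⟨δ, hδ, h⟩ := exists_norm_exp_smul_sub_one_lt 𝕜 V (ε := 1) one_pos
  refine ⟨δ, hδ, fun T hT v hv => ?_⟩
  by_contra hv0
  have h1 := h T hT 1 (by simp)
  rw [one_smul] at h1
  have h2 := (NormedSpace.exp T - 1 : V →L[𝕜] V).le_opNorm v
  have h3 : (NormedSpace.exp T - 1 : V →L[𝕜] V) v = (-2 : 𝕜) • v := by
    simp [hv, neg_smul, two_smul]; abel
  rw [h3, norm_smul] at h2
  simp at h2
  have := norm_pos_iff.2 hv0
  nlinarith

/-- Operators near the identity are exponentials of operators near zero. -/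
theorem eventually_exists_exp_eq {U : Set (V →L[𝕜] V)} (hU : U ∈ 𝓝 0) :
    ∀ᶠ g in 𝓝 (1 : V →L[𝕜] V), ∃ D ∈ U, NormedSpace.exp D = g := by
  have : CompleteSpace V := FiniteDimensional.complete 𝕜 V
  have h := (hasStrictFDerivAt_exp_zero (𝕂 := 𝕜) (𝔸 := V →L[𝕜] V)).map_nhds_eq_of_surj
    (by rw [LinearMap.range_eq_top]; exact fun x => ⟨x, rfl⟩)
  rw [NormedSpace.exp_zero] at h
  rw [← h]
  exact Filter.mem_map.2 (Filter.mem_of_superset hU fun D hD => ⟨D, hD, rfl⟩)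

end Normed

/-- A norm on a finite-dimensional vector space, transported from coordinates. -/
abbrev coordNorm (𝕜 V : Type*) [RCLike 𝕜] [AddCommGroup V] [Module 𝕜 V]
    [FiniteDimensional 𝕜 V] : NormedAddCommGroup V :=
  NormedAddCommGroup.induced V (Fin (finrank 𝕜 V) → 𝕜) (finBasis 𝕜 V).equivFun
    (finBasis 𝕜 V).equivFun.injective

/-- The norm `coordNorm` makes the vector space a normed space. -/
abbrev coordNormedSpace (𝕜 V : Type*) [RCLike 𝕜] [AddCommGroup V] [Module 𝕜 V]
    [FiniteDimensional 𝕜 V] :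
    letI := coordNorm 𝕜 V
    NormedSpace 𝕜 V :=
  letI := coordNorm 𝕜 V
  { (inferInstance : Module 𝕜 V) with
    norm_smul_le := fun a v => by
      change ‖(finBasis 𝕜 V).equivFun (a • v)‖ ≤ ‖a‖ * ‖(finBasis 𝕜 V).equivFun v‖
      rw [map_smul]; exact norm_smul_le _ _ }

section Linear

variable {𝕜 V : Type*} [RCLike 𝕜] [AddCommGroup V] [Module 𝕜 V] [FiniteDimensional 𝕜 V]

theorem expEnd_apply_of_eq_smul {T : V →ₗ[𝕜] V} {v : V} {c : 𝕜} (h : T v = c • v) :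
    expEnd 𝕜 T v = NormedSpace.exp c • v := by
  let := coordNorm 𝕜 V
  let := coordNormedSpace 𝕜 V
  have : CompleteSpace V := FiniteDimensional.complete 𝕜 V
  let T' : V →L[𝕜] V := LinearMap.toContinuousLinearMap T
  have hT : (T' : V →ₗ[𝕜] V) = T := rfl
  rw [← hT, expEnd_apply_eq_exp]
  have hs := (NormedSpace.exp_series_hasSum_exp' (𝕂 := 𝕜) T').mapL
    (ContinuousLinearMap.apply 𝕜 V v)
  have hs' := (NormedSpace.exp_series_hasSum_exp' (𝕂 := 𝕜) c).smul_const v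
  have hp : ∀ n : ℕ, (T' ^ n) v = c ^ n • v := by
    intro n
    induction n with
    | zero => simp
    | succ n ih =>
      have h' : T' v = c • v := h
      rw [pow_succ', mul_apply_eq_comp, ih, map_smul, h', smul_smul, pow_succ]
  refine hs.unique ?_
  convert hs' using 2 with n
  simp [hp, smul_smul]

theorem expEnd_apply_of_eq_zero {T : V →ₗ[𝕜] V} {v : V} (h : T v = 0) :
    expEnd 𝕜 T v = v := by
  simpa using expEnd_apply_of_eq_smul (T := T) (v := v) (c := 0) (by simpa using h)

theorem expEnd_commute {T S : V →ₗ[𝕜] V} (h : Commute T S) : Commute (expEnd 𝕜 T) S := by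
  let := coordNorm 𝕜 V
  let := coordNormedSpace 𝕜 V
  have : CompleteSpace V := FiniteDimensional.complete 𝕜 V
  let : NormedAlgebra ℚ (V →L[𝕜] V) := NormedAlgebra.restrictScalars ℚ 𝕜 _
  let T' : V →L[𝕜] V := LinearMap.toContinuousLinearMap T
  let S' : V →L[𝕜] V := LinearMap.toContinuousLinearMap S
  have hT : (T' : V →ₗ[𝕜] V) = T := rfl
  have hc : Commute T' S' := by
    ext v; exact LinearMap.congr_fun h v
  have h2 := hc.exp_left
  rw [← hT, expEnd_eq_exp]
  ext v
  exact ContinuousLinearMap.ext_iff.1 h2 v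

theorem expEnd_neg_apply_expEnd (T : V →ₗ[𝕜] V) (v : V) :
    expEnd 𝕜 (-T) (expEnd 𝕜 T v) = v := by
  let := coordNorm 𝕜 V
  let := coordNormedSpace 𝕜 V
  have : CompleteSpace V := FiniteDimensional.complete 𝕜 V
  let : NormedAlgebra ℚ (V →L[𝕜] V) := NormedAlgebra.restrictScalars ℚ 𝕜 _
  let T' : V →L[𝕜] V := LinearMap.toContinuousLinearMap T
  have hT : (T' : V →ₗ[𝕜] V) = T := rfl
  have hT' : ((-T' : V →L[𝕜] V) : V →ₗ[𝕜] V) = -T := rfl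
  rw [← hT', ← hT, expEnd_eq_exp, expEnd_eq_exp]
  have h := NormedSpace.exp_add_of_commute (Commute.neg_left (Commute.refl T'))
  rw [neg_add_cancel, NormedSpace.exp_zero] at h
  exact (ContinuousLinearMap.ext_iff.1 h v).symm

theorem expEnd_apply_expEnd_neg (T : V →ₗ[𝕜] V) (v : V) :
    expEnd 𝕜 T (expEnd 𝕜 (-T) v) = v := by
  simpa using expEnd_neg_apply_expEnd (-T) v

/-- The exponential of a derivation of a bilinear product is an automorphism of it. -/
theorem expEnd_apply_bilin (br : V →ₗ[𝕜] V →ₗ[𝕜] V) {D : V →ₗ[𝕜] V}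
    (hD : ∀ x y, D (br x y) = br (D x) y + br x (D y)) (x y : V) :
    expEnd 𝕜 D (br x y) = br (expEnd 𝕜 D x) (expEnd 𝕜 D y) := by
  let := coordNorm 𝕜 V
  let := coordNormedSpace 𝕜 V
  have : CompleteSpace V := FiniteDimensional.complete 𝕜 V
  let D' : V →L[𝕜] V := LinearMap.toContinuousLinearMap D
  let b' : V →L[𝕜] V →L[𝕜] V := LinearMap.toContinuousLinearMap
    (LinearMap.toContinuousLinearMap.toLinearMap ∘ₗ br)
  let E : 𝕜 → V →L[𝕜] V := fun s => NormedSpace.exp (s • D')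
  have hE : ∀ s v, E s v = expEnd 𝕜 (s • D) v := fun s v =>
    (expEnd_apply_eq_exp (s • D') v).symm
  have hD' : ∀ x y, D' (b' x y) = b' (D' x) y + b' x (D' y) := hD
  -- The derivative of `exp (-s D) [exp (s D) x, exp (s D) y]` vanishes.
  let f : 𝕜 → V := fun s => E (-s) (b' (E s x) (E s y))
  have hd : ∀ s, HasDerivAt f 0 s := by
    intro s
    have h1 : HasDerivAt (fun s => E (-s)) (-(E (-s) * D')) s := by
      have := (hasDerivAt_exp_smul_const D' (-s)).scomp s (hasDerivAt_neg s)
      exact this.congr_deriv (by simp [E])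
    have h2 := fun v => hasDerivAt_exp_smul_apply D' v s
    have h3 : HasDerivAt (fun s => b' (E s x) (E s y))
        (b' (E s (D' x)) (E s y) + b' (E s x) (E s (D' y))) s := by
      exact (b'.hasFDerivAt.comp_hasDerivAt s (h2 x)).clm_apply (h2 y)
    refine (h1.clm_apply h3).congr_deriv ?_
    have hc : ∀ v, E s (D' v) = D' (E s v) := fun v => by
      have : Commute (E s) D' := by
        let : NormedAlgebra ℚ (V →L[𝕜] V) := NormedAlgebra.restrictScalars ℚ 𝕜 _
        exact ((Commute.refl D').smul_left s).exp_left
      exact ContinuousLinearMap.ext_iff.1 this v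
    rw [hc, hc, ← hD']
    simp
  have hconst := is_const_of_deriv_eq_zero (𝕜 := 𝕜) (f := f)
    (fun s => (hd s).differentiableAt) (fun s => (hd s).deriv) 1 0
  have h1 : f 1 = expEnd 𝕜 (-D) (br (expEnd 𝕜 D x) (expEnd 𝕜 D y)) := by
    have a1 := hE 1 x
    have a2 := hE 1 y
    rw [one_smul] at a1 a2
    have a3 := hE (-1) (b' (E 1 x) (E 1 y))
    rw [neg_one_smul] at a3
    change E (-1) (b' (E 1 x) (E 1 y)) = _
    rw [a3, a1, a2]; rfl
  have h0 : f 0 = br x y := by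
    have a : ∀ v, E 0 v = v := fun v => by
      change (NormedSpace.exp ((0 : 𝕜) • D') : V →L[𝕜] V) v = v
      rw [zero_smul, NormedSpace.exp_zero]; rfl
    change E (-0) (b' (E 0 x) (E 0 y)) = _
    rw [neg_zero, a, a, a]; rfl
  rw [h1, h0] at hconst
  rw [← hconst, expEnd_apply_expEnd_neg]

/-- For small `s`, the operators `exp (s T)` and `s T` have the same kernel in the sense that a
fixed vector of the first is killed by the second, and `-1` is not an eigenvalue of the first. -/
theorem exists_forall_expEnd_smul (T : V →ₗ[𝕜] V) :
    ∃ δ : ℝ, 0 < δ ∧ ∀ s : 𝕜, ‖s‖ < δ →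
      (∀ v, expEnd 𝕜 (s • T) v = v → (s • T) v = 0) ∧
      (∀ v, expEnd 𝕜 (s • T) v = -v → v = 0) := by
  let := coordNorm 𝕜 V
  let := coordNormedSpace 𝕜 V
  obtain ⟨δ₁, hδ₁, h₁⟩ := exists_apply_eq_zero_of_exp_apply_eq 𝕜 V
  obtain ⟨δ₂, hδ₂, h₂⟩ := exists_eq_zero_of_exp_apply_eq_neg 𝕜 V
  let T' : V →L[𝕜] V := LinearMap.toContinuousLinearMap T
  refine ⟨min δ₁ δ₂ / (‖T'‖ + 1), by positivity, fun s hs => ?_⟩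
  have hn : ‖s • T'‖ < min δ₁ δ₂ := by
    rw [norm_smul]
    rw [lt_div_iff₀ (by positivity)] at hs
    nlinarith [norm_nonneg s]
  have hT : ((s • T' : V →L[𝕜] V) : V →ₗ[𝕜] V) = s • T := rfl
  constructor
  · intro v hv
    rw [← hT, expEnd_apply_eq_exp] at hv
    exact h₁ _ (hn.trans_le (min_le_left _ _)) v hv
  · intro v hv
    rw [← hT, expEnd_apply_eq_exp] at hv
    exact h₂ _ (hn.trans_le (min_le_right _ _)) v hv

end Linear

/-- If `B v = 0` implies `A v = 0` for commuting operators, the same holds for their powers. -/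
theorem pow_apply_eq_zero_of_commute {K V : Type*} [Field K] [AddCommGroup V]
    [Module K V] {A B : V →ₗ[K] V} (hc : Commute A B)
    (h : ∀ v, B v = 0 → A v = 0) (n : ℕ) (v : V) (hv : (B ^ n) v = 0) : (A ^ n) v = 0 := by
  induction n generalizing v with
  | zero => simpa using hv
  | succ n ih =>
    rw [pow_succ, Module.End.mul_apply]
    apply ih
    have h1 : B ((B ^ n) v) = 0 := by rwa [← Module.End.mul_apply, ← pow_succ']
    have h2 := h _ h1
    have h3 : A * B ^ n = B ^ n * A := hc.pow_right n
    rw [← Module.End.mul_apply, ← h3]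
    exact h2

/-! ### Analytic families and Engel subalgebras -/

section Family

variable {𝕜 V : Type*} [RCLike 𝕜] [AddCommGroup V] [Module 𝕜 V]

/-- A one-parameter family of endomorphisms all of whose matrix coefficients are analytic on the
whole line. -/
def IsAnalyticFamily (M : 𝕜 → End 𝕜 V) : Prop :=
  ∀ (v : V) (l : Dual 𝕜 V), AnalyticOnNhd 𝕜 (fun s => l (M s v)) Set.univ

theorem IsAnalyticFamily.const (T : End 𝕜 V) : IsAnalyticFamily fun _ : 𝕜 => T :=
  fun _ _ => analyticOnNhd_const

theorem IsAnalyticFamily.sub {M N : 𝕜 → End 𝕜 V} (hM : IsAnalyticFamily M)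
    (hN : IsAnalyticFamily N) : IsAnalyticFamily fun s => M s - N s := fun v l => by
  simpa using! (hM v l).sub (hN v l)

theorem isAnalyticFamily_add_smul (T S : End 𝕜 V) :
    IsAnalyticFamily fun s : 𝕜 => T + s • S := fun v l => by
  have h : (fun s : 𝕜 => l ((T + s • S) v)) = fun s => l (T v) + s * l (S v) := by
    funext s; simp
  rw [h]
  exact analyticOnNhd_const.add (analyticOnNhd_id.mul analyticOnNhd_const)

theorem IsAnalyticFamily.continuous_apply {M : 𝕜 → End 𝕜 V} (hM : IsAnalyticFamily M) (v : V)
    (l : Dual 𝕜 V) : Continuous fun s => l (M s v) :=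
  continuousOn_univ.1 (hM v l).continuousOn

variable [FiniteDimensional 𝕜 V]

theorem IsAnalyticFamily.mul {M N : 𝕜 → End 𝕜 V} (hM : IsAnalyticFamily M)
    (hN : IsAnalyticFamily N) : IsAnalyticFamily fun s => M s * N s := fun v l => by
  let b := finBasis 𝕜 V
  have h : (fun s => l ((M s * N s) v)) =
      fun s => ∑ i, b.coord i (N s v) * l (M s (b i)) := by
    funext s
    rw [Module.End.mul_apply]
    conv_lhs => rw [← b.sum_repr (N s v)]
    simp only [map_sum, map_smul, smul_eq_mul, Basis.coord_apply]
  rw [h]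
  exact Finset.analyticOnNhd_fun_sum _ fun i _ => (hN v _).mul (hM _ l)

theorem isAnalyticFamily_expEnd_smul (T : End 𝕜 V) :
    IsAnalyticFamily fun s : 𝕜 => expEnd 𝕜 (s • T) := fun v l => by
  let := coordNorm 𝕜 V
  let := coordNormedSpace 𝕜 V
  have : CompleteSpace V := FiniteDimensional.complete 𝕜 V
  let T' : V →L[𝕜] V := LinearMap.toContinuousLinearMap T
  let ev : (V →L[𝕜] V) →L[𝕜] 𝕜 :=
    (LinearMap.toContinuousLinearMap l).comp (ContinuousLinearMap.apply 𝕜 V v)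
  have h : (fun s : 𝕜 => l (expEnd 𝕜 (s • T) v)) =
      fun s => ev (NormedSpace.exp (s • T')) := by
    funext s
    have := expEnd_apply_eq_exp (s • T') v
    exact congrArg l this
  rw [h]
  intro s _
  refine (ev.analyticAt _).comp ((NormedSpace.exp_analytic (𝕂 := 𝕜) _).comp ?_)
  exact analyticAt_id.smul analyticAt_const

/-- By the identity theorem for the coefficients of the characteristic polynomial, a lower bound
for the multiplicity of the eigenvalue `0` in an analytic family propagates from a neighbourhood
of `0` to the whole line. -/
theorem IsAnalyticFamily.le_finrank_maxGenEigenspace {M : 𝕜 → End 𝕜 V}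
    (hM : IsAnalyticFamily M) {d : ℕ}
    (h : ∀ᶠ s in 𝓝 (0 : 𝕜), d ≤ finrank 𝕜 ((M s).maxGenEigenspace 0)) (s : 𝕜) :
    d ≤ finrank 𝕜 ((M s).maxGenEigenspace 0) := by
  let b := finBasis 𝕜 V
  simp_rw [LinearMap.finrank_maxGenEigenspace_zero_eq] at h ⊢
  refine Polynomial.le_natTrailingDegree (LinearMap.charpoly_monic _).ne_zero fun i hi => ?_
  have han : AnalyticOnNhd 𝕜 (fun s => (M s).charpoly.coeff i) Set.univ := by
    have e : (fun s => (M s).charpoly.coeff i) = fun s =>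
        MvPolynomial.aeval (fun p : Fin (finrank 𝕜 V) × Fin (finrank 𝕜 V) =>
          LinearMap.toMatrix b b (M s) p.1 p.2)
          ((Matrix.charpoly.univ 𝕜 (Fin (finrank 𝕜 V))).coeff i) := by
      funext s
      rw [← LinearMap.charpoly_toMatrix (M s) b]
      exact (Matrix.charpoly.univ_coeff_eval₂Hom (Fin (finrank 𝕜 V)) (algebraMap 𝕜 𝕜)
        (fun p => LinearMap.toMatrix b b (M s) p.1 p.2) i).symm
    rw [e]
    refine AnalyticOnNhd.aeval_mvPolynomial (fun p => ?_) _
    have e2 : (fun s => LinearMap.toMatrix b b (M s) p.1 p.2) =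
        fun s => b.coord p.1 (M s (b p.2)) := by
      funext s; simp [LinearMap.toMatrix_apply]
    rw [e2]
    exact hM _ _
  have hz : (fun s => (M s).charpoly.coeff i) =ᶠ[𝓝 0] fun _ => 0 := by
    filter_upwards [h] with s hs
    exact Polynomial.coeff_eq_zero_of_lt_natTrailingDegree (hi.trans_le hs)
  exact han.eqOn_of_preconnected_of_eventuallyEq analyticOnNhd_const isPreconnected_univ
    (Set.mem_univ 0) hz (Set.mem_univ s)

end Family

section Ad

variable {𝕜 L : Type*} [RCLike 𝕜] [LieRing L] [LieAlgebra 𝕜 L]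

theorem ker_le_maxGenEigenspace_zero {K V : Type*} [Field K] [AddCommGroup V] [Module K V]
    (T : End K V) : LinearMap.ker T ≤ T.maxGenEigenspace 0 := by
  intro v hv
  rw [End.mem_maxGenEigenspace]
  exact ⟨1, by simpa using hv⟩

variable (𝕜 L) in
/-- The bracket of a Lie algebra as a bilinear map. -/
def bracketBilin : L →ₗ[𝕜] L →ₗ[𝕜] L := (LieAlgebra.ad 𝕜 L : L →ₗ[𝕜] End 𝕜 L)

@[simp] theorem bracketBilin_apply (x y : L) : bracketBilin 𝕜 L x y = ⁅x, y⁆ := rfl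

variable [FiniteDimensional 𝕜 L]

theorem expEnd_ad_lie (x u v : L) :
    expEnd 𝕜 (LieAlgebra.ad 𝕜 L x) ⁅u, v⁆ =
      ⁅expEnd 𝕜 (LieAlgebra.ad 𝕜 L x) u, expEnd 𝕜 (LieAlgebra.ad 𝕜 L x) v⁆ :=
  expEnd_apply_bilin (bracketBilin 𝕜 L) (by intro u v; simp) u v

/-- The map `(x, h) ↦ exp (ad x) h` on `L × 𝔠(X)` is a submersion at `(0, X)`, so every element
near `X` is conjugate to an element of the centralizer `𝔠(X)`; as this is abelian, the centralizer
of the element is at least as large as that of `X`. -/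
theorem eventually_finrank_ker_ad_le (X : L)
    (hab : ∀ u v : L, ⁅X, u⁆ = 0 → ⁅X, v⁆ = 0 → ⁅u, v⁆ = 0)
    (hsp : ∀ v : L, ∃ a b : L, ⁅X, a⁆ = 0 ∧ v = a + ⁅X, b⁆) (z : L) :
    ∀ᶠ s in 𝓝 (0 : 𝕜), finrank 𝕜 (LinearMap.ker (LieAlgebra.ad 𝕜 L X)) ≤
      finrank 𝕜 (LinearMap.ker (LieAlgebra.ad 𝕜 L (X + s • z))) := by
  let := coordNorm 𝕜 L
  let := coordNormedSpace 𝕜 L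
  have : CompleteSpace L := FiniteDimensional.complete 𝕜 L
  let C : Submodule 𝕜 L := LinearMap.ker (LieAlgebra.ad 𝕜 L X : L →ₗ[𝕜] L)
  have : CompleteSpace C := FiniteDimensional.complete 𝕜 C
  have hC : ∀ u : L, u ∈ C ↔ ⁅X, u⁆ = 0 := fun u => Iff.rfl
  let A : L →L[𝕜] L →L[𝕜] L := LinearMap.toContinuousLinearMap
    (LinearMap.toContinuousLinearMap.toLinearMap ∘ₗ bracketBilin 𝕜 L)
  have hA : ∀ x y, A x y = ⁅x, y⁆ := fun _ _ => rfl
  let X' : C := ⟨X, (hC X).2 (lie_self X)⟩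
  let F : L × C → L := fun p => (NormedSpace.exp (A p.1) : L →L[𝕜] L) p.2
  have hF : HasStrictFDerivAt F
      ((A.flip X).comp (ContinuousLinearMap.fst 𝕜 L C) +
        C.subtypeL.comp (ContinuousLinearMap.snd 𝕜 L C)) ((0 : L), X') := by
    have h0 : HasStrictFDerivAt (NormedSpace.exp : (L →L[𝕜] L) → (L →L[𝕜] L))
        (1 : (L →L[𝕜] L) →L[𝕜] (L →L[𝕜] L)) (A ((0 : L), X').1) := by
      rw [map_zero]; exact hasStrictFDerivAt_exp_zero
    have h1 := h0.comp ((0 : L), X') (A.hasStrictFDerivAt.comp ((0 : L), X') hasStrictFDerivAt_fst)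
    have h2 : HasStrictFDerivAt (fun p : L × C => (p.2 : L))
        (C.subtypeL.comp (ContinuousLinearMap.snd 𝕜 L C)) ((0 : L), X') :=
      C.subtypeL.hasStrictFDerivAt.comp ((0 : L), X') hasStrictFDerivAt_snd
    refine (h1.clm_apply h2).congr_fderiv ?_
    ext p
    · simp [X']
    · simp [X']
  have hsurj : ((A.flip X).comp (ContinuousLinearMap.fst 𝕜 L C) +
        C.subtypeL.comp (ContinuousLinearMap.snd 𝕜 L C)).range = ⊤ := by
    rw [LinearMap.range_eq_top]
    intro v
    obtain ⟨a, b, ha, rfl⟩ := hsp v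
    refine ⟨(-b, ⟨a, (hC a).2 ha⟩), ?_⟩
    have : A.flip X (-b) + a = a + ⁅X, b⁆ := by
      rw [ContinuousLinearMap.flip_apply, hA, neg_lie, lie_skew, add_comm]
    exact this
  have hF0 : F ((0 : L), X') = X := by simp [F, X']
  have hmap := hF.map_nhds_eq_of_surj hsurj
  rw [hF0] at hmap
  have hrange : Set.range F ∈ 𝓝 X := by
    rw [← hmap]; exact Filter.mem_map.2 (Filter.univ_mem' fun p => ⟨p, rfl⟩)
  have hline : Filter.Tendsto (fun s : 𝕜 => X + s • z) (𝓝 0) (𝓝 X) := by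
    have : Continuous fun s : 𝕜 => X + s • z := by fun_prop
    simpa using this.tendsto 0
  filter_upwards [hline hrange] with s hs
  obtain ⟨⟨x, h⟩, hxh⟩ := hs
  let T : L →ₗ[𝕜] L := LieAlgebra.ad 𝕜 L x
  have hx : expEnd 𝕜 T (h : L) = X + s • z := by
    exact (expEnd_apply_eq_exp (A x) (h : L)).trans hxh
  have hle : C.map (expEnd 𝕜 T) ≤
      LinearMap.ker (LieAlgebra.ad 𝕜 L (X + s • z) : L →ₗ[𝕜] L) := by
    rintro _ ⟨u, hu, rfl⟩
    rw [LinearMap.mem_ker, ← hx, LieAlgebra.ad_apply, ← expEnd_ad_lie, hab _ _ h.2 hu, map_zero]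
  have hinj : Function.Injective (expEnd 𝕜 T) :=
    (Function.LeftInverse.injective (expEnd_neg_apply_expEnd T))
  calc finrank 𝕜 C = finrank 𝕜 (C.map (expEnd 𝕜 T)) :=
        (LinearEquiv.finrank_eq (Submodule.equivMapOfInjective _ hinj C))
    _ ≤ _ := Submodule.finrank_mono hle

/-- If the centralizer of `X` is abelian and complementary to the image of `ad X`, then its
dimension is a lower bound for the dimensions of all Engel subalgebras. -/
theorem finrank_ker_ad_le_finrank_maxGenEigenspace (X : L)
    (hab : ∀ u v : L, ⁅X, u⁆ = 0 → ⁅X, v⁆ = 0 → ⁅u, v⁆ = 0)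
    (hsp : ∀ v : L, ∃ a b : L, ⁅X, a⁆ = 0 ∧ v = a + ⁅X, b⁆) (y : L) :
    finrank 𝕜 (LinearMap.ker (LieAlgebra.ad 𝕜 L X)) ≤
      finrank 𝕜 ((LieAlgebra.ad 𝕜 L y).maxGenEigenspace 0) := by
  have han := isAnalyticFamily_add_smul (𝕜 := 𝕜) (LieAlgebra.ad 𝕜 L X) (LieAlgebra.ad 𝕜 L (y - X))
  have h := han.le_finrank_maxGenEigenspace
    (d := finrank 𝕜 (LinearMap.ker (LieAlgebra.ad 𝕜 L X))) (by
      filter_upwards [eventually_finrank_ker_ad_le (𝕜 := 𝕜) X hab hsp (y - X)] with s hs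
      refine hs.trans ?_
      rw [map_add, map_smul]
      exact Submodule.finrank_mono (ker_le_maxGenEigenspace_zero _)) 1
  rwa [one_smul, ← map_add, add_sub_cancel] at h

end Ad

/-! ### Multiplicities of inner automorphisms -/

/-- The logarithm of an automorphism close to the identity is a derivation: if `exp D` preserves a
bilinear product and `D` is small, then `D` is a derivation of it. -/
theorem exists_leibniz_of_exp_bilin {𝕜 V : Type*} [RCLike 𝕜] [NormedAddCommGroup V]
    [NormedSpace 𝕜 V] [FiniteDimensional 𝕜 V] (m : V →L[𝕜] V →L[𝕜] V) :
    ∃ δ > 0, ∀ D : V →L[𝕜] V, ‖D‖ < δ →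
      (∀ x y, (NormedSpace.exp D : V →L[𝕜] V) (m x y) =
        m ((NormedSpace.exp D : V →L[𝕜] V) x) ((NormedSpace.exp D : V →L[𝕜] V) y)) →
      ∀ x y, D (m x y) = m (D x) y + m x (D y) := by
  have : CompleteSpace V := FiniteDimensional.complete 𝕜 V
  -- For `ε = 1 / 8` one has `ε (1 + ε)² + ε (1 + ε) + ε = (1 + ε)³ - 1 < 1 / 2`; this sum bounds
  -- the derivative of the path `f` below in units of `‖n‖ ‖x‖ ‖y‖`.
  obtain ⟨δ, hδ, h⟩ := exists_norm_exp_smul_sub_one_lt 𝕜 V (ε := 1 / 8) (by norm_num)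
  refine ⟨δ, hδ, fun D hD hm => ?_⟩
  let : NormedSpace ℝ V := NormedSpace.restrictScalars ℝ 𝕜 V
  -- The defect of the Leibniz rule.
  let n : V →L[𝕜] V →L[𝕜] V :=
    (ContinuousLinearMap.compL 𝕜 V V V D).comp m - m.comp D - (m.flip.comp D).flip
  have hn : ∀ x y, n x y = D (m x y) - m (D x) y - m x (D y) := fun x y => by
    simp [n]
  let E : 𝕜 → V →L[𝕜] V := fun s => NormedSpace.exp (s • D)
  have hE' : ∀ s : 𝕜, ‖s‖ ≤ 1 → ∀ v, ‖E s v - v‖ ≤ 1 / 8 * ‖v‖ := fun s hs v =>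
    ((E s - 1).le_opNorm v).trans (by gcongr; exact (h D hD s hs).le)
  have hcomm : ∀ s v, E s (D v) = D (E s v) := fun s v => by
    have : Commute (E s) D := by
      let : NormedAlgebra ℚ (V →L[𝕜] V) := NormedAlgebra.restrictScalars ℚ 𝕜 _
      exact ((Commute.refl D).smul_left _).exp_left
    exact ContinuousLinearMap.ext_iff.1 this v
  have hEn : ∀ s : 𝕜, ‖s‖ ≤ 1 → ∀ v, ‖E s v‖ ≤ 9 / 8 * ‖v‖ := fun s hs v => by
    have h1 := hE' s hs v
    have h2 := norm_le_norm_add_norm_sub' (E s v) v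
    linarith
  have hE1 : ∀ s : 𝕜, ∀ v, E s (E (-s) v) = v := fun s v => by
    let : NormedAlgebra ℚ (V →L[𝕜] V) := NormedAlgebra.restrictScalars ℚ 𝕜 _
    have := NormedSpace.exp_add_of_commute (Commute.neg_right (Commute.refl (s • D)))
    rw [add_neg_cancel, NormedSpace.exp_zero, ← neg_smul] at this
    exact (ContinuousLinearMap.ext_iff.1 this v).symm
  -- Compare `exp (s D) m (exp (-s D) x) (exp (-s D) y)` with its first-order expansion.
  have key : ∀ x y, ‖n x y‖ ≤ 1 / 2 * ‖n‖ * ‖x‖ * ‖y‖ := by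
    intro x y
    let f : 𝕜 → V := fun s => E s (m (E (-s) x) (E (-s) y)) - s • n x y
    have hf : ∀ s, HasDerivAt f (E s (n (E (-s) x) (E (-s) y)) - n x y) s := by
      intro s
      have h1 : HasDerivAt E (E s * D) s := hasDerivAt_exp_smul_const D s
      have h2 : ∀ v, HasDerivAt (fun s => E (-s) v) (-(D (E (-s) v))) s := fun v => by
        have := (hasDerivAt_exp_smul_apply D v (-s)).scomp s (hasDerivAt_neg s)
        refine this.congr_deriv ?_
        rw [neg_one_smul, neg_inj]
        exact hcomm _ _
      have h3 := (m.hasFDerivAt.comp_hasDerivAt s (h2 x)).clm_apply (h2 y)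
      have h4 := (h1.clm_apply h3).sub ((hasDerivAt_id s).smul_const (n x y))
      refine h4.congr_deriv ?_
      rw [one_smul, sub_left_inj, hn]
      simp only [mul_apply_eq_comp, map_neg, neg_apply, map_add, map_sub, Function.comp_apply]
      abel
    have hfr : ∀ s ∈ Set.Icc (0 : ℝ) 1, HasDerivWithinAt (fun s : ℝ => f (s : 𝕜))
        (E s (n (E (-s) x) (E (-s) y)) - n x y) (Set.Icc 0 1) s := by
      intro s _
      have hr : HasDerivAt (fun r : ℝ => (r : 𝕜)) 1 s := by
        simpa using (RCLike.ofRealCLM (K := 𝕜)).hasDerivAt (x := s)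
      exact (((hf s).scomp s hr).congr_deriv (one_smul _ _)).hasDerivWithinAt
    have hb := norm_image_sub_le_of_norm_deriv_le_segment_01' hfr
      (C := 1 / 2 * ‖n‖ * ‖x‖ * ‖y‖) (by
        intro s hs
        have hs1 : ‖(s : 𝕜)‖ ≤ 1 := by
          rw [RCLike.norm_ofReal, abs_of_nonneg hs.1]; exact hs.2.le
        have hs2 : ‖-(s : 𝕜)‖ ≤ 1 := by rwa [norm_neg]
        set x' := E (-s) x
        set y' := E (-s) y
        have e : E s (n x' y') - n x y = (E s (n x' y') - n x' y') + n (x' - x) y' +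
            n x (y' - y) := by simp
        have b1 : ‖x'‖ ≤ 9 / 8 * ‖x‖ := hEn _ hs2 x
        have b2 : ‖y'‖ ≤ 9 / 8 * ‖y‖ := hEn _ hs2 y
        have b3 : ‖x' - x‖ ≤ 1 / 8 * ‖x‖ := hE' _ hs2 x
        have b4 : ‖y' - y‖ ≤ 1 / 8 * ‖y‖ := hE' _ hs2 y
        have c1 : ‖E s (n x' y') - n x' y'‖ ≤ 1 / 8 * (‖n‖ * (9 / 8 * ‖x‖) * (9 / 8 * ‖y‖)) := by
          refine (hE' _ hs1 _).trans ?_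
          gcongr
          exact (n.le_opNorm₂ x' y').trans (by gcongr)
        have c2 : ‖n (x' - x) y'‖ ≤ ‖n‖ * (1 / 8 * ‖x‖) * (9 / 8 * ‖y‖) :=
          (n.le_opNorm₂ _ _).trans (by gcongr)
        have c3 : ‖n x (y' - y)‖ ≤ ‖n‖ * ‖x‖ * (1 / 8 * ‖y‖) :=
          (n.le_opNorm₂ _ _).trans (by gcongr)
        rw [e]
        refine (norm_add₃_le).trans ?_
        have : 0 ≤ ‖n‖ * ‖x‖ * ‖y‖ := by positivity
        nlinarith)
    have hf1 : f 1 = m x y - n x y := by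
      have e : E 1 = NormedSpace.exp D := by simp [E]
      have : E 1 (m (E (-1) x) (E (-1) y)) = m x y := by
        have h5 := hm (E (-1) x) (E (-1) y)
        rw [← e] at h5
        rw [h5, hE1, hE1]
      simp only [f, this, one_smul]
    have hf0 : f 0 = m x y := by simp [f, E]
    simpa [hf1, hf0] using hb
  -- The defect `n` is at most half of itself, hence zero.
  have hnn : ‖n‖ ≤ 1 / 2 * ‖n‖ :=
    n.opNorm_le_bound₂ (by positivity) key
  have hn0 : ‖n‖ = 0 := le_antisymm (by linarith) (norm_nonneg n)
  intro x y
  have h1 : n x y = 0 := by simpa [hn0] using key x y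
  rw [hn, sub_sub, sub_eq_zero] at h1
  exact h1

section Inner

variable {𝕜 L : Type*} [RCLike 𝕜] [LieRing L] [LieAlgebra 𝕜 L] [FiniteDimensional 𝕜 L]

/-- An inner automorphism can be joined to the identity by an analytic path of automorphisms which
are trivial on the centre. -/
theorem exists_analytic_path_of_mem_innerAutomorphisms {g : L ≃ₗ[𝕜] L}
    (hg : g ∈ innerAutomorphisms 𝕜 L) :
    ∃ M N : 𝕜 → End 𝕜 L, IsAnalyticFamily M ∧ IsAnalyticFamily N ∧
      M 0 = 1 ∧ N 0 = 1 ∧ M 1 = (g : L →ₗ[𝕜] L) ∧ N 1 = ((g⁻¹ : L ≃ₗ[𝕜] L) : L →ₗ[𝕜] L) ∧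
      (∀ s x y, M s ⁅x, y⁆ = ⁅M s x, M s y⁆) ∧ (∀ s x y, N s ⁅x, y⁆ = ⁅N s x, N s y⁆) ∧
      (∀ s z, (∀ x : L, ⁅x, z⁆ = 0) → M s z = z) ∧
      (∀ s z, (∀ x : L, ⁅x, z⁆ = 0) → N s z = z) := by
  induction hg using Subgroup.closure_induction with
  | mem φ hφ =>
    obtain ⟨x, hx⟩ := hφ
    have hz : ∀ (s : 𝕜) z, (∀ x : L, ⁅x, z⁆ = 0) →
        expEnd 𝕜 (s • LieAlgebra.ad 𝕜 L x) z = z := fun s z hz =>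
      expEnd_apply_of_eq_zero (by simp [hz])
    have hz' : ∀ (s : 𝕜) z, (∀ x : L, ⁅x, z⁆ = 0) →
        expEnd 𝕜 (s • (-LieAlgebra.ad 𝕜 L x)) z = z := fun s z hz =>
      expEnd_apply_of_eq_zero (by simp [hz])
    have h0 : expEnd 𝕜 (0 : End 𝕜 L) = 1 := by
      ext v; exact expEnd_apply_of_eq_zero (by simp)
    refine ⟨fun s => expEnd 𝕜 (s • LieAlgebra.ad 𝕜 L x),
      fun s => expEnd 𝕜 (s • (-LieAlgebra.ad 𝕜 L x)), isAnalyticFamily_expEnd_smul _,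
      isAnalyticFamily_expEnd_smul _, by simp only [zero_smul]; exact h0,
      by simp only [zero_smul]; exact h0, by simp only [one_smul]; exact hx.symm,
      ?_, ?_, ?_, hz, hz'⟩
    · simp only [one_smul]
      ext v
      have : φ (expEnd 𝕜 (-LieAlgebra.ad 𝕜 L x) v) = v := by
        have h := LinearMap.congr_fun hx (expEnd 𝕜 (-LieAlgebra.ad 𝕜 L x) v)
        exact h.trans (expEnd_apply_expEnd_neg _ v)
      change _ = φ.symm v
      rw [LinearEquiv.eq_symm_apply, this]
    · intro s u v
      simp only [← map_smul]
      exact expEnd_ad_lie _ u v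
    · intro s u v
      simp only [← map_smul, ← map_neg]
      exact expEnd_ad_lie _ u v
  | one => exact ⟨fun _ => 1, fun _ => 1, .const _, .const _, rfl, rfl, rfl, rfl,
      fun _ _ _ => rfl, fun _ _ _ => rfl, fun _ _ _ => rfl, fun _ _ _ => rfl⟩
  | mul a b _ _ iha ihb =>
    obtain ⟨M, N, hM, hN, hM0, hN0, hM1, hN1, hMb, hNb, hMz, hNz⟩ := iha
    obtain ⟨M', N', hM', hN', hM0', hN0', hM1', hN1', hMb', hNb', hMz', hNz'⟩ := ihb
    refine ⟨fun s => M s * M' s, fun s => N' s * N s, hM.mul hM', hN'.mul hN,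
      by simp [hM0, hM0'], by simp [hN0, hN0'], ?_, ?_, ?_, ?_, ?_, ?_⟩
    · simp only [hM1, hM1']; rfl
    · simp only [hN1, hN1', mul_inv_rev]; rfl
    · intro s x y; simp [hMb, hMb']
    · intro s x y; simp [hNb, hNb']
    · intro s z hz; simp [hMz s z hz, hMz' s z hz]
    · intro s z hz; simp [hNz s z hz, hNz' s z hz]
  | inv a _ iha =>
    obtain ⟨M, N, hM, hN, hM0, hN0, hM1, hN1, hMb, hNb, hMz, hNz⟩ := iha
    exact ⟨N, M, hN, hM, hN0, hM0, hN1, by simpa using hM1, hNb, hMb, hNz, hMz⟩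

/-- If every derivation killing the centre is inner, then the eigenvalue `1` of an inner
automorphism has at least the multiplicity which `0` has as an eigenvalue of every `ad d`. Near the
identity inner automorphisms are exponentials of inner derivations, and the bound propagates along
an analytic path. -/
theorem le_finrank_maxGenEigenspace_sub_one_of_mem_innerAutomorphisms
    (hder : ∀ D : End 𝕜 L, (∀ x y : L, D ⁅x, y⁆ = ⁅D x, y⁆ + ⁅x, D y⁆) →
      (∀ z : L, (∀ x : L, ⁅x, z⁆ = 0) → D z = 0) → ∃ d : L, D = LieAlgebra.ad 𝕜 L d)
    {r : ℕ} (hr : ∀ d : L, r ≤ finrank 𝕜 ((LieAlgebra.ad 𝕜 L d).maxGenEigenspace 0))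
    {g : L ≃ₗ[𝕜] L} (hg : g ∈ innerAutomorphisms 𝕜 L) :
    r ≤ finrank 𝕜 (End.maxGenEigenspace ((g : L →ₗ[𝕜] L) - 1) 0) := by
  obtain ⟨M, -, hM, -, hM0, -, hM1, -, hMb, -, hMz, -⟩ :=
    exists_analytic_path_of_mem_innerAutomorphisms hg
  rw [← hM1]
  refine (hM.sub (.const 1)).le_finrank_maxGenEigenspace ?_ 1
  let := coordNorm 𝕜 L
  let := coordNormedSpace 𝕜 L
  have : CompleteSpace L := FiniteDimensional.complete 𝕜 L
  let A : L →L[𝕜] L →L[𝕜] L := LinearMap.toContinuousLinearMap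
    (LinearMap.toContinuousLinearMap.toLinearMap ∘ₗ bracketBilin 𝕜 L)
  obtain ⟨δ₁, hδ₁, h₁⟩ := exists_leibniz_of_exp_bilin A
  obtain ⟨δ₂, hδ₂, h₂⟩ := exists_apply_eq_zero_of_exp_apply_eq 𝕜 L
  have hU : Metric.ball (0 : L →L[𝕜] L) (min δ₁ δ₂) ∈ 𝓝 0 :=
    Metric.ball_mem_nhds _ (lt_min hδ₁ hδ₂)
  let M' : 𝕜 → L →L[𝕜] L := fun s => LinearMap.toContinuousLinearMap (M s)
  have hM' : Continuous M' := by
    rw [continuous_clm_apply]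
    intro v
    have e : (fun s => M' s v) = fun s => ∑ i, (finBasis 𝕜 L).coord i (M s v) • finBasis 𝕜 L i := by
      funext s; exact ((finBasis 𝕜 L).sum_repr (M s v)).symm
    rw [e]
    exact continuous_finsetSum _ fun i _ => (hM.continuous_apply v _).smul continuous_const
  have hlim : Filter.Tendsto M' (𝓝 0) (𝓝 1) := by
    have := hM'.tendsto 0
    have e : M' 0 = 1 := by ext v; change M 0 v = v; rw [hM0]; rfl
    rwa [e] at this
  filter_upwards [hlim (eventually_exists_exp_eq hU)] with s hs
  obtain ⟨D, hD, hDs⟩ := hs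
  rw [mem_ball_zero_iff] at hD
  have hexp : ∀ v, (NormedSpace.exp D : L →L[𝕜] L) v = M s v := fun v => by rw [hDs]; rfl
  obtain ⟨d, hd⟩ := hder D
    (h₁ D (hD.trans_le (min_le_left _ _)) fun x y => by
      simp only [hexp]; exact hMb s x y)
    (fun z hz => h₂ D (hD.trans_le (min_le_right _ _)) z (by rw [hexp, hMz s z hz]))
  refine (hr d).trans (Submodule.finrank_mono ?_)
  have hMs : M s = expEnd 𝕜 (LieAlgebra.ad 𝕜 L d) := by
    ext v; rw [← hexp, ← hd, expEnd_apply_eq_exp]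
  intro v hv
  rw [End.mem_maxGenEigenspace] at hv ⊢
  obtain ⟨k, hk⟩ := hv
  refine ⟨k, ?_⟩
  rw [zero_smul, sub_zero] at hk ⊢
  refine pow_apply_eq_zero_of_commute ?_ ?_ k v hk
  · rw [hMs]
    exact (expEnd_commute (Commute.refl _)).sub_left (Commute.one_left _)
  · intro v hv
    rw [hMs, LinearMap.sub_apply, expEnd_apply_of_eq_zero hv]
    simp

end Inner

/-! ### Ranks and Cartan involutions -/

section LinearAlgebra

variable {K V : Type*} [Field K] [AddCommGroup V] [Module K V]

theorem apply_eq_zero_of_pow_apply_eq_zero {A : End K V} (hA : ∀ v, A (A v) = 0 → A v = 0)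
    (n : ℕ) {v : V} (hv : (A ^ n) v = 0) : A v = 0 := by
  induction n with
  | zero => simp_all
  | succ n ih =>
    rcases n with _ | n
    · simpa using hv
    · apply ih
      rw [pow_succ', Module.End.mul_apply]
      apply hA
      simpa [pow_succ'] using hv

theorem maxGenEigenspace_zero_eq_ker {A : End K V} (hA : ∀ v, A (A v) = 0 → A v = 0) :
    A.maxGenEigenspace 0 = LinearMap.ker A := by
  refine le_antisymm (fun v hv => ?_) (ker_le_maxGenEigenspace_zero A)
  rw [End.mem_maxGenEigenspace] at hv
  obtain ⟨k, hk⟩ := hv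
  rw [zero_smul, sub_zero] at hk
  exact apply_eq_zero_of_pow_apply_eq_zero hA k hk

variable [FiniteDimensional K V]

/-- The space is the sum of kernel and image of an endomorphism `A` with `ker A² = ker A`. -/
theorem exists_ker_add_range {A : End K V} (hA : ∀ v, A (A v) = 0 → A v = 0) (v : V) :
    ∃ a b, A a = 0 ∧ v = a + A b := by
  have hd : Disjoint (LinearMap.ker A) (LinearMap.range A) := by
    rw [Submodule.disjoint_def]
    rintro _ h ⟨u, rfl⟩
    exact hA u h
  have ht : LinearMap.ker A ⊔ LinearMap.range A = ⊤ := by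
    apply Submodule.eq_top_of_disjoint _ _ _ hd
    rw [add_comm, LinearMap.finrank_range_add_finrank_ker]
  have hv : v ∈ LinearMap.ker A ⊔ LinearMap.range A := by rw [ht]; trivial
  obtain ⟨a, ha, _, ⟨b, rfl⟩, h⟩ := Submodule.mem_sup.1 hv
  exact ⟨a, b, ha, h.symm⟩

/-- A suitable perturbation `A + s C` of `A` by a commuting operator has no larger kernel:
`-s⁻¹` has to avoid the eigenvalues of `A⁻¹ C` on the image of `A`. -/
theorem exists_ne_zero_ker_add_smul_le [Infinite K] {A C : End K V} (hc : Commute A C)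
    (hA : ∀ v, A (A v) = 0 → A v = 0) :
    ∃ s : K, s ≠ 0 ∧ ∀ v, (A + s • C) v = 0 → A v = 0 := by
  classical
  let W := LinearMap.range A
  have hcomm : ∀ v, A (C v) = C (A v) := fun v => LinearMap.congr_fun hc v
  have hAW : ∀ w ∈ W, A w ∈ W := fun w _ => ⟨w, rfl⟩
  have hCW : ∀ w ∈ W, C w ∈ W := by
    rintro _ ⟨u, rfl⟩
    exact ⟨C u, hcomm u⟩
  have hinj : Function.Injective (A.restrict hAW) := by
    rw [← LinearMap.ker_eq_bot, LinearMap.ker_eq_bot']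
    rintro ⟨_, ⟨u, rfl⟩⟩ h
    have h' : A (A u) = 0 := congrArg Subtype.val h
    exact Subtype.ext (hA u h')
  let e : W ≃ₗ[K] W := LinearEquiv.ofInjectiveEndo (A.restrict hAW) hinj
  let N : End K W := e.symm.toLinearMap ∘ₗ C.restrict hCW
  obtain ⟨c, hc'⟩ := Infinite.exists_notMem_finset ((End.finite_hasEigenvalue N).toFinset ∪ {0})
  simp only [Finset.mem_union, Set.Finite.mem_toFinset, Finset.mem_singleton, not_or] at hc'
  obtain ⟨hN, hc0⟩ := hc'
  refine ⟨-c⁻¹, by simpa using hc0, fun v hv => ?_⟩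
  let w : W := ⟨A v, v, rfl⟩
  have h1 : A w = c⁻¹ • C w := by
    have hv' : A v + (-c⁻¹) • C v = 0 := hv
    have := congrArg A hv'
    rw [map_add, map_smul, hcomm, map_zero, neg_smul] at this
    exact (add_neg_eq_zero.1 this)
  have h2 : e w = c⁻¹ • C.restrict hCW w := Subtype.ext h1
  have h3 : N w = c • w := by
    have h4 : C.restrict hCW w = c • e w := by rw [h2, smul_smul, mul_inv_cancel₀ hc0, one_smul]
    change e.symm (C.restrict hCW w) = _
    rw [h4, map_smul, e.symm_apply_apply]
  by_contra hne
  have hw : w ≠ 0 := fun h => hne (congrArg Subtype.val h)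
  exact hN (End.hasEigenvalue_of_hasEigenvector (x := w) ⟨End.mem_eigenspace_iff.2 h3, hw⟩)

end LinearAlgebra

section Rank

variable {L : Type*} [LieRing L] [LieAlgebra ℝ L] [FiniteDimensional ℝ L]

/-- The rank is the dimension of the centralizer of `X`, if this is abelian and a complement of
the image of `ad X`. -/
theorem rank_eq_finrank_ker_ad {X : L}
    (hab : ∀ u v : L, ⁅X, u⁆ = 0 → ⁅X, v⁆ = 0 → ⁅u, v⁆ = 0)
    (hss : ∀ v : L, ⁅X, ⁅X, v⁆⁆ = 0 → ⁅X, v⁆ = 0) :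
    LieAlgebra.rank ℝ L = finrank ℝ (LinearMap.ker (LieAlgebra.ad ℝ L X)) := by
  have hsp := exists_ker_add_range (A := LieAlgebra.ad ℝ L X) hss
  apply le_antisymm
  · have h := LieAlgebra.rank_le_finrank_engel ℝ X
    have e := maxGenEigenspace_zero_eq_ker (A := LieAlgebra.ad ℝ L X) hss
    rw [← e]
    exact h
  · obtain ⟨y, hy⟩ := LieAlgebra.exists_isRegular ℝ L
    rw [LieAlgebra.isRegular_iff_finrank_engel_eq_rank] at hy
    rw [← hy]
    exact finrank_ker_ad_le_finrank_maxGenEigenspace X hab hsp y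

end Rank

section Cartan

variable {L : Type*} [LieRing L] [LieAlgebra ℝ L]

/-- `S` is a `θ`-invariant inner product on `L` for which the adjoint of `ad x` is `-ad (θ x)`. -/
structure IsCartanForm (θ : L ≃ₗ⁅ℝ⁆ L) (S : LinearMap.BilinForm ℝ L) : Prop where
  symm : ∀ x y, S x y = S y x
  map_map : ∀ x y, S (θ x) (θ y) = S x y
  pos : ∀ x, x ≠ 0 → 0 < S x x
  lie_left : ∀ x y z, S ⁅x, y⁆ z = -S y ⁅θ x, z⁆

/-- If `B` is an invariant form as in the definition of a Cartan involution, the inner product is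
`S x y = -B x (θ y)`. -/
theorem IsCartanInvolution.exists_isCartanForm {θ : L ≃ₗ⁅ℝ⁆ L} (hθ : IsCartanInvolution θ) :
    ∃ S, IsCartanForm θ S := by
  obtain ⟨B, h1, h2, h3, h4⟩ := hθ.exists_form
  have hi := hθ.involutive
  refine ⟨-(B.compRight θ.toLinearEquiv.toLinearMap), ?_, ?_, ?_, ?_⟩
  · intro x y
    change -B x (θ y) = -B y (θ x)
    rw [← h3 x, hi, h1]
  · intro x y
    change -B (θ x) (θ (θ y)) = -B x (θ y)
    rw [h3]
  · exact h4
  · intro x y z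
    change -B ⁅x, y⁆ (θ z) = - -B y (θ ⁅θ x, z⁆)
    rw [← lie_skew, map_neg, LinearMap.neg_apply, h2, LieEquiv.map_lie, hi]

namespace IsCartanForm

variable {θ : L ≃ₗ⁅ℝ⁆ L} {S : LinearMap.BilinForm ℝ L}

theorem nonneg (hS : IsCartanForm θ S) (x : L) : 0 ≤ S x x := by
  by_cases h : x = 0
  · simp [h]
  · exact (hS.pos x h).le

theorem eq_zero (hS : IsCartanForm θ S) {x : L} (h : S x x = 0) : x = 0 := by
  by_contra h'
  exact (hS.pos x h').ne' h

theorem lie_eq_zero_of_lie_lie_eq_zero (hS : IsCartanForm θ S) {X : L} (hX : θ X = X) (v : L)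
    (h : ⁅X, ⁅X, v⁆⁆ = 0) : ⁅X, v⁆ = 0 := by
  apply hS.eq_zero
  rw [hS.lie_left, hX, h, map_zero, neg_zero]

variable [FiniteDimensional ℝ L]

/-- There is an element of `𝔨` with abelian centralizer in `L`. -/
theorem exists_abelian_centralizer (hS : IsCartanForm θ S) (hi : ∀ x, θ (θ x) = x) :
    ∃ X : L, θ X = X ∧ ∀ u v : L, ⁅X, u⁆ = 0 → ⁅X, v⁆ = 0 → ⁅u, v⁆ = 0 := by
  -- Take `X` in `𝔨` with centralizer as small as possible.
  let f : fixedSubalgebra θ → ℕ := fun X =>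
    finrank ℝ (LinearMap.ker (LieAlgebra.ad ℝ L (X : L)))
  obtain ⟨⟨X, hX⟩, -, hmin⟩ := (measure f).wf.has_min Set.univ ⟨0, trivial⟩
  have hX : θ X = X := hX
  have hmin : ∀ Y : L, θ Y = Y → finrank ℝ (LinearMap.ker (LieAlgebra.ad ℝ L X)) ≤
      finrank ℝ (LinearMap.ker (LieAlgebra.ad ℝ L Y)) := fun Y hY =>
    not_lt.1 (hmin (⟨Y, hY⟩ : fixedSubalgebra θ) trivial)
  have hss := hS.lie_eq_zero_of_lie_lie_eq_zero hX
  -- By minimality, `X + s Y` has the same centralizer as `X`.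
  have hk : ∀ Y z : L, θ Y = Y → ⁅X, Y⁆ = 0 → ⁅X, z⁆ = 0 → ⁅Y, z⁆ = 0 := by
    intro Y z hY hXY hz
    have hc : Commute (LieAlgebra.ad ℝ L X) (LieAlgebra.ad ℝ L Y) := by
      refine LinearMap.ext fun v => ?_
      change ⁅X, ⁅Y, v⁆⁆ = ⁅Y, ⁅X, v⁆⁆
      rw [leibniz_lie, hXY, zero_lie, zero_add]
    obtain ⟨s, hs, h⟩ := exists_ne_zero_ker_add_smul_le hc hss
    have hle : LinearMap.ker (LieAlgebra.ad ℝ L (X + s • Y)) ≤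
        LinearMap.ker (LieAlgebra.ad ℝ L X) := fun v hv => h v (by simpa using hv)
    have heq := Submodule.eq_of_le_of_finrank_le hle (hmin _ (by simp [hX, hY]))
    have hz' : z ∈ LinearMap.ker (LieAlgebra.ad ℝ L (X + s • Y)) := by rw [heq]; exact hz
    have : s • ⁅Y, z⁆ = 0 := by simpa [hz] using hz'
    exact (smul_eq_zero.1 this).resolve_left hs
  have hXθ : ∀ u : L, ⁅X, u⁆ = 0 → ⁅X, θ u⁆ = 0 := fun u hu => by
    have := congrArg θ hu
    rwa [LieEquiv.map_lie, hX, map_zero] at this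
  refine ⟨X, hX, fun u v hu hv => ?_⟩
  -- For `p`, `q` in the `-1`-eigenspace, `⁅p, q⁆` lies in `𝔨` and centralizes `X`, so it kills `p`,
  -- and `S ⁅p, q⁆ ⁅p, q⁆ = S q ⁅p, ⁅p, q⁆⁆ = 0`.
  have hpp : ∀ p q : L, θ p = -p → θ q = -q → ⁅X, p⁆ = 0 → ⁅X, q⁆ = 0 → ⁅p, q⁆ = 0 := by
    intro p q hp hq hXp hXq
    have hT : θ ⁅p, q⁆ = ⁅p, q⁆ := by rw [LieEquiv.map_lie, hp, hq, lie_neg, neg_lie, neg_neg]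
    have hXT : ⁅X, ⁅p, q⁆⁆ = 0 := by rw [leibniz_lie, hXp, hXq, zero_lie, lie_zero, add_zero]
    have hTp : ⁅p, ⁅p, q⁆⁆ = 0 := by rw [← lie_skew, hk _ p hT hXT hXp, neg_zero]
    apply hS.eq_zero
    rw [hS.lie_left, hp, neg_lie, hTp, neg_zero, map_zero, neg_zero]
  -- Split `u` and `v` into their components in `𝔨` and `𝔭`.
  have hu2 : ⁅X, u + θ u⁆ = 0 := by rw [lie_add, hu, hXθ u hu, add_zero]
  have hv2 : ⁅X, v + θ v⁆ = 0 := by rw [lie_add, hv, hXθ v hv, add_zero]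
  have hu3 : ⁅X, u - θ u⁆ = 0 := by rw [lie_sub, hu, hXθ u hu, sub_zero]
  have hv3 : ⁅X, v - θ v⁆ = 0 := by rw [lie_sub, hv, hXθ v hv, sub_zero]
  have hku : θ (u + θ u) = u + θ u := by rw [map_add, hi, add_comm]
  have hkv : θ (v + θ v) = v + θ v := by rw [map_add, hi, add_comm]
  have h1 : ⁅u + θ u, v⁆ = 0 := hk _ _ hku hu2 hv
  have h2 : ⁅u - θ u, v + θ v⁆ = 0 := by rw [← lie_skew, hk _ _ hkv hv2 hu3, neg_zero]
  have h3 : ⁅u - θ u, v - θ v⁆ = 0 :=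
    hpp _ _ (by rw [map_sub, hi, neg_sub]) (by rw [map_sub, hi, neg_sub]) hu3 hv3
  have h4 : (4 : ℝ) • ⁅u, v⁆ =
      (2 : ℝ) • ⁅u + θ u, v⁆ + ⁅u - θ u, v + θ v⁆ + ⁅u - θ u, v - θ v⁆ := by
    simp only [add_lie, sub_lie, lie_add, lie_sub]
    module
  rw [h1, h2, h3] at h4
  simpa using h4

/-- The rank of `𝔨` is maximal exactly if the centralizer of `X`, a Cartan subalgebra, lies
in `𝔨`. -/
theorem hasMaximalRank_iff (hS : IsCartanForm θ S) {X : L} (hX : θ X = X)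
    (hab : ∀ u v : L, ⁅X, u⁆ = 0 → ⁅X, v⁆ = 0 → ⁅u, v⁆ = 0) :
    HasMaximalRank (fixedSubalgebra θ) ↔
      LinearMap.ker (LieAlgebra.ad ℝ L X) ≤ (fixedSubalgebra θ).toSubmodule := by
  have hss := hS.lie_eq_zero_of_lie_lie_eq_zero hX
  let X' : fixedSubalgebra θ := ⟨X, hX⟩
  have hL := rank_eq_finrank_ker_ad hab hss
  have hK := rank_eq_finrank_ker_ad (L := fixedSubalgebra θ) (X := X')
    (fun u v hu hv => Subtype.ext (hab u v (congrArg Subtype.val hu) (congrArg Subtype.val hv)))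
    (fun v hv => Subtype.ext (hss v (congrArg Subtype.val hv)))
  have hmap : (LinearMap.ker (LieAlgebra.ad ℝ (fixedSubalgebra θ) X')).map
      (fixedSubalgebra θ).toSubmodule.subtype =
      LinearMap.ker (LieAlgebra.ad ℝ L X) ⊓ (fixedSubalgebra θ).toSubmodule := by
    ext u
    constructor
    · rintro ⟨v, hv, rfl⟩
      exact ⟨congrArg Subtype.val hv, v.2⟩
    · rintro ⟨h1, h2⟩
      exact ⟨⟨u, h2⟩, Subtype.ext h1, rfl⟩
  have hfin : finrank ℝ (LinearMap.ker (LieAlgebra.ad ℝ L X) ⊓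
      (fixedSubalgebra θ).toSubmodule : Submodule ℝ L) =
      finrank ℝ (LinearMap.ker (LieAlgebra.ad ℝ (fixedSubalgebra θ) X')) := by
    rw [← hmap]
    exact Submodule.finrank_map_subtype_eq (fixedSubalgebra θ).toSubmodule _
  rw [HasMaximalRank, hL, hK.trans hfin.symm]
  constructor
  · intro h
    have := Submodule.eq_of_le_of_finrank_le inf_le_left h.ge
    exact inf_eq_left.1 this
  · intro h
    rw [inf_eq_left.2 h]

/-- The centralizer of `X` as a subalgebra is a Cartan subalgebra. -/
theorem exists_isCompactCartanSubalgebra (hS : IsCartanForm θ S) {X : L} (hX : θ X = X)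
    (hab : ∀ u v : L, ⁅X, u⁆ = 0 → ⁅X, v⁆ = 0 → ⁅u, v⁆ = 0)
    (hk : LinearMap.ker (LieAlgebra.ad ℝ L X) ≤ (fixedSubalgebra θ).toSubmodule) :
    ∃ h : LieSubalgebra ℝ L, IsCompactCartanSubalgebra θ h := by
  let h : LieSubalgebra ℝ L :=
    { LinearMap.ker (LieAlgebra.ad ℝ L X) with
      lie_mem' := fun {u v} hu hv => by
        have : ⁅u, v⁆ = 0 := hab u v hu hv
        change ⁅u, v⁆ ∈ LinearMap.ker (LieAlgebra.ad ℝ L X)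
        rw [this]; exact zero_mem _ }
  have hmem : ∀ u : L, u ∈ h ↔ ⁅X, u⁆ = 0 := fun u => Iff.rfl
  refine ⟨h, ⟨?_, ?_⟩, 1, one_mem _, fun x hx => hk hx⟩
  · have : IsLieAbelian h := ⟨fun u v => Subtype.ext (hab u v u.2 v.2)⟩
    infer_instance
  · refine le_antisymm (fun y hy => ?_) h.le_normalizer
    rw [LieSubalgebra.mem_normalizer_iff] at hy
    have h1 := hy X ((hmem X).2 (lie_self X))
    have h2 : ⁅X, ⁅X, y⁆⁆ = 0 := by
      rw [← lie_skew X y, lie_neg, (hmem _).1 h1, neg_zero]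
    exact hS.lie_eq_zero_of_lie_lie_eq_zero hX y h2

end IsCartanForm

end Cartan

/-! ### The complexification and its inner product -/

section Complexification

variable {L : Type*} [AddCommGroup L] [Module ℝ L]

/-- The real part of an element of the complexification. -/
def rePart : ℂ ⊗[ℝ] L →ₗ[ℝ] L :=
  TensorProduct.lift (LinearMap.lsmul ℝ L ∘ₗ Complex.reLm)

/-- The imaginary part of an element of the complexification. -/
def imPart : ℂ ⊗[ℝ] L →ₗ[ℝ] L :=
  TensorProduct.lift (LinearMap.lsmul ℝ L ∘ₗ Complex.imLm)

@[simp] theorem rePart_tmul (c : ℂ) (a : L) : rePart (c ⊗ₜ[ℝ] a) = c.re • a := rfl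

@[simp] theorem imPart_tmul (c : ℂ) (a : L) : imPart (c ⊗ₜ[ℝ] a) = c.im • a := rfl

theorem eq_rePart_add_imPart (u : ℂ ⊗[ℝ] L) :
    u = (1 : ℂ) ⊗ₜ[ℝ] rePart u + Complex.I ⊗ₜ[ℝ] imPart u := by
  induction u with
  | zero => simp
  | tmul c a =>
    rw [rePart_tmul, imPart_tmul, ← TensorProduct.smul_tmul, ← TensorProduct.smul_tmul,
      ← TensorProduct.add_tmul]
    congr 1
    apply Complex.ext <;> simp
  | add x y hx hy =>
    conv_lhs => rw [hx, hy]
    simp only [map_add, TensorProduct.tmul_add]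
    abel

theorem complexification_ext {u v : ℂ ⊗[ℝ] L} (h1 : rePart u = rePart v)
    (h2 : imPart u = imPart v) : u = v := by
  rw [eq_rePart_add_imPart u, eq_rePart_add_imPart v, h1, h2]

@[simp] theorem rePart_smul (c : ℂ) (u : ℂ ⊗[ℝ] L) :
    rePart (c • u) = c.re • rePart u - c.im • imPart u := by
  induction u with
  | zero => simp
  | tmul d a => simp [TensorProduct.smul_tmul', sub_smul, mul_smul]
  | add x y hx hy => rw [smul_add, map_add, hx, hy, map_add, map_add, smul_add, smul_add]; abel

@[simp] theorem imPart_smul (c : ℂ) (u : ℂ ⊗[ℝ] L) :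
    imPart (c • u) = c.re • imPart u + c.im • rePart u := by
  induction u with
  | zero => simp
  | tmul d a => simp [TensorProduct.smul_tmul', add_smul, mul_smul]
  | add x y hx hy => rw [smul_add, map_add, hx, hy, map_add, map_add, smul_add, smul_add]; abel

@[simp] theorem rePart_baseChange (f : L →ₗ[ℝ] L) (u : ℂ ⊗[ℝ] L) :
    rePart (f.baseChange ℂ u) = f (rePart u) := by
  induction u with
  | zero => simp
  | tmul d a => simp
  | add x y hx hy => simp [hx, hy]

@[simp] theorem imPart_baseChange (f : L →ₗ[ℝ] L) (u : ℂ ⊗[ℝ] L) :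
    imPart (f.baseChange ℂ u) = f (imPart u) := by
  induction u with
  | zero => simp
  | tmul d a => simp
  | add x y hx hy => simp [hx, hy]

/-- The Hermitian extension of a real bilinear form, conjugate-linear in the first variable. -/
def hermitianExtension (S : LinearMap.BilinForm ℝ L) (u v : ℂ ⊗[ℝ] L) : ℂ :=
  ⟨S (rePart u) (rePart v) + S (imPart u) (imPart v),
    S (rePart u) (imPart v) - S (imPart u) (rePart v)⟩

variable [FiniteDimensional ℝ L]

open scoped Matrix.Norms.Operator in
theorem expEnd_baseChange (T : L →ₗ[ℝ] L) :
    expEnd ℂ (T.baseChange ℂ) = (expEnd ℝ T).baseChange ℂ := by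
  let b := finBasis ℝ L
  let c := Algebra.TensorProduct.basis ℂ b
  have key : ∀ f : L →ₗ[ℝ] L, LinearMap.toMatrix c c (f.baseChange ℂ) =
      (algebraMap ℝ ℂ).mapMatrix (LinearMap.toMatrix b b f) := fun f =>
    LinearMap.toMatrix_baseChange ℂ f b b
  apply (LinearMap.toMatrix c c).injective
  rw [toMatrix_expEnd, key, key, toMatrix_expEnd]
  let f : Matrix (Fin (finrank ℝ L)) (Fin (finrank ℝ L)) ℝ →+*
      Matrix (Fin (finrank ℝ L)) (Fin (finrank ℝ L)) ℂ := (algebraMap ℝ ℂ).mapMatrix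
  have hf : Continuous f := continuous_id.matrix_map Complex.continuous_ofReal
  exact (NormedSpace.map_exp f hf _).symm

/-- The multiplicity of the eigenvalue `0` is read off the characteristic polynomial, so it does not
change under complexification. -/
theorem finrank_maxGenEigenspace_baseChange (f : End ℝ L) :
    finrank ℂ (End.maxGenEigenspace (f.baseChange ℂ) 0) = finrank ℝ (f.maxGenEigenspace 0) := by
  rw [LinearMap.finrank_maxGenEigenspace_zero_eq, LinearMap.finrank_maxGenEigenspace_zero_eq,
    LinearMap.charpoly_baseChange]
  rw [Polynomial.natTrailingDegree, Polynomial.natTrailingDegree, Polynomial.trailingDegree,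
    Polynomial.trailingDegree, Polynomial.support_map_of_injective _ (algebraMap ℝ ℂ).injective]

end Complexification

section LieComplexification

variable {L : Type*} [LieRing L] [LieAlgebra ℝ L]

@[simp] theorem rePart_lie (u v : ℂ ⊗[ℝ] L) :
    rePart ⁅u, v⁆ = ⁅rePart u, rePart v⁆ - ⁅imPart u, imPart v⁆ := by
  conv_lhs => rw [eq_rePart_add_imPart u, eq_rePart_add_imPart v]
  simp [LieAlgebra.ExtendScalars.bracket_tmul, sub_eq_add_neg]

@[simp] theorem imPart_lie (u v : ℂ ⊗[ℝ] L) :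
    imPart ⁅u, v⁆ = ⁅rePart u, imPart v⁆ + ⁅imPart u, rePart v⁆ := by
  conv_lhs => rw [eq_rePart_add_imPart u, eq_rePart_add_imPart v]
  simp [LieAlgebra.ExtendScalars.bracket_tmul]

theorem ad_one_tmul (X : L) :
    LieAlgebra.ad ℂ (ℂ ⊗[ℝ] L) ((1 : ℂ) ⊗ₜ[ℝ] X) = (LieAlgebra.ad ℝ L X).baseChange ℂ := by
  refine LinearMap.ext fun u => complexification_ext ?_ ?_
  · rw [rePart_baseChange, LieAlgebra.ad_apply, rePart_lie]; simp
  · rw [imPart_baseChange, LieAlgebra.ad_apply, imPart_lie]; simp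

/-- The composite of `θ` with complex conjugation: the conjugation of the complexification with
respect to its compact real form. -/
def compactConj (θ : L ≃ₗ⁅ℝ⁆ L) (u : ℂ ⊗[ℝ] L) : ℂ ⊗[ℝ] L :=
  (1 : ℂ) ⊗ₜ[ℝ] θ (rePart u) - Complex.I ⊗ₜ[ℝ] θ (imPart u)

@[simp] theorem rePart_compactConj (θ : L ≃ₗ⁅ℝ⁆ L) (u : ℂ ⊗[ℝ] L) :
    rePart (compactConj θ u) = θ (rePart u) := by simp [compactConj]

@[simp] theorem imPart_compactConj (θ : L ≃ₗ⁅ℝ⁆ L) (u : ℂ ⊗[ℝ] L) :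
    imPart (compactConj θ u) = -θ (imPart u) := by simp [compactConj]

namespace IsCartanForm

variable {θ : L ≃ₗ⁅ℝ⁆ L} {S : LinearMap.BilinForm ℝ L}

/-- The Hermitian extension of a Cartan form is an inner product on the complexification. -/
abbrev hermitianCore (hS : IsCartanForm θ S) : InnerProductSpace.Core ℂ (ℂ ⊗[ℝ] L) where
  inner := hermitianExtension S
  conj_inner_symm u v := by
    apply Complex.ext
    · simp [hermitianExtension, hS.symm (rePart u), hS.symm (imPart u)]
    · simp [hermitianExtension, hS.symm (rePart u), hS.symm (imPart u)]
  re_inner_nonneg u := add_nonneg (hS.nonneg _) (hS.nonneg _)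
  add_left u v w := by
    apply Complex.ext
    · simp [hermitianExtension]; ring
    · simp [hermitianExtension]; ring
  smul_left u v c := by
    apply Complex.ext
    · simp [hermitianExtension]; ring
    · simp [hermitianExtension]; ring
  definite u h := by
    have h1 : S (rePart u) (rePart u) + S (imPart u) (imPart u) = 0 := congrArg Complex.re h
    have h2 := hS.nonneg (rePart u)
    have h3 := hS.nonneg (imPart u)
    exact complexification_ext (by rw [map_zero]; exact hS.eq_zero (by linarith))
      (by rw [map_zero]; exact hS.eq_zero (by linarith))

theorem hermitianExtension_lie (hS : IsCartanForm θ S) (x y z : ℂ ⊗[ℝ] L) :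
    hermitianExtension S ⁅x, y⁆ z = -hermitianExtension S y ⁅compactConj θ x, z⁆ := by
  apply Complex.ext
  · simp only [hermitianExtension, rePart_lie, imPart_lie, rePart_compactConj, imPart_compactConj,
      map_add, map_sub, LinearMap.add_apply, LinearMap.sub_apply, hS.lie_left, neg_lie, map_neg,
      Complex.neg_re]
    ring
  · simp only [hermitianExtension, rePart_lie, imPart_lie, rePart_compactConj, imPart_compactConj,
      map_add, map_sub, LinearMap.add_apply, LinearMap.sub_apply, hS.lie_left, neg_lie, map_neg,
      Complex.neg_im]
    ring

end IsCartanForm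

end LieComplexification

section Derivation

variable {V : Type*} [LieRing V] [LieAlgebra ℂ V] [FiniteDimensional ℂ V]

/-- The Killing form of a complex Lie algebra carrying an inner product and a conjugation `σ` with
`(ad x)* = -ad (σ x)` vanishes only on the centre. -/
theorem ad_eq_zero_of_killingForm_eq_zero (c : InnerProductSpace.Core ℂ V) (σ : V → V)
    (hσ : ∀ x y z : V, c.inner ⁅x, y⁆ z = -c.inner y ⁅σ x, z⁆) (hσσ : ∀ x, σ (σ x) = x)
    {x : V} (hx : killingForm ℂ V x = 0) (z : V) : ⁅x, z⁆ = 0 := by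
  let := c.toNormedAddCommGroup
  let : InnerProductSpace ℂ V := InnerProductSpace.ofCore c.toCore
  have hin : ∀ u v : V, c.inner u v = inner ℂ u v := fun _ _ => rfl
  simp only [hin] at hσ
  let e := stdOrthonormalBasis ℂ V
  have h1 : LinearMap.trace ℂ V (LieAlgebra.ad ℂ V x ∘ₗ LieAlgebra.ad ℂ V (σ x)) = 0 := by
    rw [← killingForm_apply_apply, hx]; rfl
  rw [LinearMap.trace_eq_sum_inner _ e] at h1
  have h2 : ∀ i, inner ℂ (e i) ((LieAlgebra.ad ℂ V x ∘ₗ LieAlgebra.ad ℂ V (σ x)) (e i)) =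
      -((‖⁅σ x, e i⁆‖ ^ 2 : ℝ) : ℂ) := fun i => by
    have := hσ (σ x) (e i) ⁅σ x, e i⁆
    rw [hσσ, inner_self_eq_norm_sq_to_K] at this
    change inner ℂ (e i) ⁅x, ⁅σ x, e i⁆⁆ = _
    rw [← neg_inj, ← this]; simp
  simp only [h2, Finset.sum_neg_distrib, neg_eq_zero, ← Complex.ofReal_sum] at h1
  rw [Complex.ofReal_eq_zero, Finset.sum_eq_zero_iff_of_nonneg (fun i _ => by positivity)] at h1
  have h3 : LieAlgebra.ad ℂ V (σ x) = 0 := by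
    refine e.toBasis.ext fun i => ?_
    have := h1 i (Finset.mem_univ i)
    simpa using this
  have h4 : ∀ y : V, ⁅σ x, y⁆ = 0 := fun y => by
    have := LinearMap.congr_fun h3 y
    exact this
  have h5 := hσ (σ x) ⁅x, z⁆ z
  rw [h4, inner_zero_left, hσσ, eq_comm, neg_eq_zero, inner_self_eq_zero] at h5
  exact h5

/-- A derivation which kills the centre is inner, for a complex Lie algebra with an inner product
for which `(ad x)* = -ad (σ x)`. -/
theorem exists_eq_ad_of_leibniz (c : InnerProductSpace.Core ℂ V) (σ : V → V)
    (hσ : ∀ x y z : V, c.inner ⁅x, y⁆ z = -c.inner y ⁅σ x, z⁆) (hσσ : ∀ x, σ (σ x) = x)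
    (D : End ℂ V) (hD : ∀ x y : V, D ⁅x, y⁆ = ⁅D x, y⁆ + ⁅x, D y⁆)
    (hDz : ∀ z : V, (∀ x : V, ⁅x, z⁆ = 0) → D z = 0) : ∃ d : V, D = LieAlgebra.ad ℂ V d := by
  have hker := fun x hx => ad_eq_zero_of_killingForm_eq_zero c σ hσ hσσ (x := x) hx
  let τ : V →ₗ[ℂ] Dual ℂ V := killingForm ℂ V
  -- The functional `x ↦ tr (D ad x)` is represented by some `d` under the Killing form.
  let φ : Dual ℂ V := LinearMap.trace ℂ V ∘ₗ LinearMap.mulLeft ℂ D ∘ₗ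
    (LieAlgebra.ad ℂ V : V →ₗ[ℂ] End ℂ V)
  have hφ : ∀ x, φ x = LinearMap.trace ℂ V (D * LieAlgebra.ad ℂ V x) := fun _ => rfl
  have hφmem : φ ∈ (LinearMap.ker τ).dualAnnihilator := by
    rw [Submodule.mem_dualAnnihilator]
    intro x hx
    have : LieAlgebra.ad ℂ V x = 0 := LinearMap.ext fun z => hker x hx z
    rw [hφ, this, mul_zero, map_zero]
  rw [← LinearMap.range_dualMap_eq_dualAnnihilator_ker] at hφmem
  obtain ⟨F, hF⟩ := hφmem
  obtain ⟨d, rfl⟩ := (evalEquiv ℂ V).surjective F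
  have hd : ∀ x, LinearMap.trace ℂ V (LieAlgebra.ad ℂ V d * LieAlgebra.ad ℂ V x) =
      LinearMap.trace ℂ V (D * LieAlgebra.ad ℂ V x) := fun x => by
    rw [← hφ, ← hF, LinearMap.trace_mul_comm]
    exact (killingForm_apply_apply ℂ V x d).symm
  refine ⟨d, ?_⟩
  let E : End ℂ V := D - LieAlgebra.ad ℂ V d
  have hE : ∀ x y : V, E ⁅x, y⁆ = ⁅E x, y⁆ + ⁅x, E y⁆ := fun x y => by
    simp only [E, LinearMap.sub_apply, LieAlgebra.ad_apply, hD, leibniz_lie d x y, sub_lie, lie_sub]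
    abel
  have hEtr : ∀ x, LinearMap.trace ℂ V (E * LieAlgebra.ad ℂ V x) = 0 := fun x => by
    rw [sub_mul, map_sub, hd, sub_self]
  -- `E = D - ad d` is orthogonal to all `ad x` under the trace form, so its values are central.
  have hEc : ∀ x z : V, ⁅E x, z⁆ = 0 := fun x => by
    refine hker (E x) (LinearMap.ext fun y => ?_)
    have h1 : LieAlgebra.ad ℂ V (E x) = E * LieAlgebra.ad ℂ V x - LieAlgebra.ad ℂ V x * E := by
      refine LinearMap.ext fun z => ?_
      change ⁅E x, z⁆ = E ⁅x, z⁆ - ⁅x, E z⁆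
      rw [hE]; abel
    have h2 := hEtr ⁅x, y⁆
    have h3 : LieAlgebra.ad ℂ V ⁅x, y⁆ = LieAlgebra.ad ℂ V x * LieAlgebra.ad ℂ V y -
        LieAlgebra.ad ℂ V y * LieAlgebra.ad ℂ V x := by
      refine LinearMap.ext fun z => ?_
      change ⁅⁅x, y⁆, z⁆ = ⁅x, ⁅y, z⁆⁆ - ⁅y, ⁅x, z⁆⁆
      exact lie_lie x y z
    rw [h3, mul_sub, map_sub, sub_eq_zero] at h2
    rw [killingForm_apply_apply]
    change LinearMap.trace ℂ V (LieAlgebra.ad ℂ V (E x) * LieAlgebra.ad ℂ V y) = 0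
    rw [h1, sub_mul, map_sub, sub_eq_zero, mul_assoc, h2, ← mul_assoc, LinearMap.trace_mul_comm,
      ← mul_assoc]
  have hE0 : ∀ x y : V, E ⁅x, y⁆ = 0 := fun x y => by
    rw [hE, hEc, zero_add, ← lie_skew, hEc, neg_zero]
  have hEz : ∀ z : V, (∀ x : V, ⁅x, z⁆ = 0) → E z = 0 := fun z hz => by
    simp [E, hDz z hz, hz d]
  let := c.toNormedAddCommGroup
  let : InnerProductSpace ℂ V := InnerProductSpace.ofCore c.toCore
  have hin : ∀ u v : V, c.inner u v = inner ℂ u v := fun _ _ => rfl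
  simp only [hin] at hσ
  -- `E` kills all brackets, and the orthogonal complement of the brackets is the centre.
  have htop : LinearMap.ker E = ⊤ := by
    rw [← Submodule.orthogonal_eq_bot_iff, eq_bot_iff]
    intro y hy
    rw [Submodule.mem_orthogonal] at hy
    have hyc : ∀ x : V, ⁅x, y⁆ = 0 := fun x => by
      have h1 := hσ (σ x) ⁅x, y⁆ y
      rw [hσσ, hy _ (hE0 _ _), eq_comm, neg_eq_zero, inner_self_eq_zero] at h1
      exact h1
    exact inner_self_eq_zero.1 (hy y (hEz y hyc))
  have hE00 : E = 0 := LinearMap.ker_eq_top.1 htop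
  exact sub_eq_zero.1 hE00

end Derivation

section InnerImpliesRank

variable {L : Type*} [LieRing L] [LieAlgebra ℝ L] [FiniteDimensional ℝ L]

/-- If `θ` is inner on the complexification, an abelian centralizer of an element of `𝔨` lies in
`𝔨`: the eigenvalue `1` of `θ exp (s ad X)` has multiplicity at least the dimension of the
centralizer, and its generalized eigenvectors are fixed by `θ` and centralize `X`. -/
theorem IsCartanForm.centralizer_le_of_isInnerOnComplexification {θ : L ≃ₗ⁅ℝ⁆ L}
    {S : LinearMap.BilinForm ℝ L} (hS : IsCartanForm θ S) (hi : ∀ x, θ (θ x) = x)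
    {X : L} (hX : θ X = X) (hab : ∀ u v : L, ⁅X, u⁆ = 0 → ⁅X, v⁆ = 0 → ⁅u, v⁆ = 0)
    (hin : IsInnerOnComplexification θ) :
    LinearMap.ker (LieAlgebra.ad ℝ L X) ≤ (fixedSubalgebra θ).toSubmodule := by
  have hss := hS.lie_eq_zero_of_lie_lie_eq_zero hX
  let A : End ℝ L := LieAlgebra.ad ℝ L X
  -- The dimension of the centralizer of `X` bounds all multiplicities in the complexification.
  have hr : ∀ d : ℂ ⊗[ℝ] L, finrank ℝ (LinearMap.ker A) ≤
      finrank ℂ ((LieAlgebra.ad ℂ (ℂ ⊗[ℝ] L) d).maxGenEigenspace 0) := by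
    intro d
    let Y : ℂ ⊗[ℝ] L := (1 : ℂ) ⊗ₜ[ℝ] X
    have hre : ∀ u : ℂ ⊗[ℝ] L, rePart ⁅Y, u⁆ = ⁅X, rePart u⁆ := fun u => by
      simp [Y]
    have him : ∀ u : ℂ ⊗[ℝ] L, imPart ⁅Y, u⁆ = ⁅X, imPart u⁆ := fun u => by simp [Y]
    have hzero : ∀ u : ℂ ⊗[ℝ] L, ⁅Y, u⁆ = 0 → ⁅X, rePart u⁆ = 0 ∧ ⁅X, imPart u⁆ = 0 :=
      fun u hu => ⟨by rw [← hre, hu, map_zero], by rw [← him, hu, map_zero]⟩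
    have hssY : ∀ u : ℂ ⊗[ℝ] L, ⁅Y, ⁅Y, u⁆⁆ = 0 → ⁅Y, u⁆ = 0 := fun u hu => by
      obtain ⟨h1, h2⟩ := hzero _ hu
      rw [hre] at h1
      rw [him] at h2
      exact complexification_ext (by rw [hre, hss _ h1, map_zero]) (by rw [him, hss _ h2, map_zero])
    have habY : ∀ u v : ℂ ⊗[ℝ] L, ⁅Y, u⁆ = 0 → ⁅Y, v⁆ = 0 → ⁅u, v⁆ = 0 := fun u v hu hv => by
      obtain ⟨h1, h2⟩ := hzero _ hu
      obtain ⟨h3, h4⟩ := hzero _ hv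
      exact complexification_ext (by rw [rePart_lie, hab _ _ h1 h3, hab _ _ h2 h4]; simp)
        (by rw [imPart_lie, hab _ _ h1 h4, hab _ _ h2 h3]; simp)
    have h := finrank_ker_ad_le_finrank_maxGenEigenspace (𝕜 := ℂ) Y habY
      (exists_ker_add_range (A := LieAlgebra.ad ℂ (ℂ ⊗[ℝ] L) Y) hssY) d
    have e1 := maxGenEigenspace_zero_eq_ker (A := LieAlgebra.ad ℂ (ℂ ⊗[ℝ] L) Y) hssY
    have e2 := maxGenEigenspace_zero_eq_ker (A := A) hss
    have e3 : finrank ℂ ((LieAlgebra.ad ℂ (ℂ ⊗[ℝ] L) Y).maxGenEigenspace 0) =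
        finrank ℝ (A.maxGenEigenspace 0) := by
      rw [ad_one_tmul]; exact finrank_maxGenEigenspace_baseChange A
    rw [← e2, ← e3, e1]
    exact h
  have hder := exists_eq_ad_of_leibniz hS.hermitianCore (compactConj θ) hS.hermitianExtension_lie
    (fun u => complexification_ext (by simp [hi]) (by simp [hi]))
  -- Multiply `θ` by a small element `exp (s ad X)` of the torus.
  obtain ⟨δ, hδ, hs⟩ := exists_forall_expEnd_smul A
  let s : ℝ := δ / 2
  have hs0 : s ≠ 0 := by positivity
  obtain ⟨hs1, hs2⟩ := hs s (by
    rw [Real.norm_eq_abs, abs_of_pos (by positivity)]; exact half_lt_self hδ)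
  let Θ : End ℝ L := θ.toLinearEquiv.toLinearMap
  have hΘ : ∀ x, Θ x = θ x := fun _ => rfl
  obtain ⟨φ, hφ⟩ := exists_linearEquiv_eq_expEnd
    (LieAlgebra.ad ℂ (ℂ ⊗[ℝ] L) ((1 : ℂ) ⊗ₜ[ℝ] (s • X)))
  have hφmem : φ ∈ innerAutomorphisms ℂ (ℂ ⊗[ℝ] L) := Subgroup.subset_closure ⟨_, hφ⟩
  have hmain := le_finrank_maxGenEigenspace_sub_one_of_mem_innerAutomorphisms hder hr
    (mul_mem hin hφmem)
  let G : End ℝ L := Θ * expEnd ℝ (s • A) - 1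
  have hG : (((θ.toLinearEquiv.baseChange ℝ ℂ L L * φ : _ ≃ₗ[ℂ] _) : _ →ₗ[ℂ] _) - 1 :
      ℂ ⊗[ℝ] L →ₗ[ℂ] ℂ ⊗[ℝ] L) = G.baseChange ℂ := by
    have h1 : (φ : ℂ ⊗[ℝ] L →ₗ[ℂ] ℂ ⊗[ℝ] L) = (expEnd ℝ (s • A)).baseChange ℂ := by
      rw [hφ, ad_one_tmul, expEnd_baseChange, map_smul]
    refine LinearMap.ext fun u => ?_
    have h2 := LinearMap.congr_fun h1 u
    change θ.toLinearEquiv.toLinearMap.baseChange ℂ (φ u) - u = G.baseChange ℂ u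
    rw [show φ u = (expEnd ℝ (s • A)).baseChange ℂ u from h2]
    refine complexification_ext ?_ ?_
    · simp only [map_sub, rePart_baseChange]; rfl
    · simp only [map_sub, imPart_baseChange]; rfl
  rw [hG, finrank_maxGenEigenspace_baseChange] at hmain
  have hΘA : Commute Θ A := LinearMap.ext fun v => by
    change θ ⁅X, v⁆ = ⁅X, θ v⁆
    rw [LieEquiv.map_lie, hX]
  have hEA : Commute (expEnd ℝ (s • A)) A := expEnd_commute ((Commute.refl A).smul_left s)
  have hEΘ : Commute (expEnd ℝ (s • A)) Θ := expEnd_commute (hΘA.symm.smul_left s)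
  -- Fixed vectors of `θ exp (s ad X)` lie in `𝔨` and commute with `X`.
  have hfix : ∀ v, G v = 0 → A v = 0 ∧ Θ v = v := by
    intro v hv
    have hv1 : Θ (expEnd ℝ (s • A) v) = v := sub_eq_zero.1 hv
    have hEΘ' : ∀ w, expEnd ℝ (s • A) (Θ w) = Θ (expEnd ℝ (s • A) w) :=
      fun w => LinearMap.congr_fun hEΘ w
    have hv2 : expEnd ℝ (s • A) v = Θ v := by
      have := congrArg θ hv1
      rwa [hΘ, hi] at this
    have hv3 : expEnd ℝ (s • A) (Θ v) = v := by rw [hEΘ', hv1]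
    -- `v - θ v` is an eigenvector of `exp (s ad X)` for the eigenvalue `-1`, which is excluded.
    have hp : v - Θ v = 0 := hs2 _ (by rw [map_sub, hv2, hv3, neg_sub])
    have hv4 : Θ v = v := (sub_eq_zero.1 hp).symm
    have hA : (s • A) v = 0 := hs1 v (by rw [hv2, hv4])
    exact ⟨(smul_eq_zero.1 hA).resolve_left hs0, hv4⟩
  have hGA : Commute A G :=
    ((hΘA.symm).mul_right hEA.symm).sub_right (Commute.one_right _)
  have hGΘ : Commute (Θ - 1) G :=
    ((((Commute.refl Θ).mul_right hEΘ.symm).sub_right (Commute.one_right _))).sub_left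
      (Commute.one_left _)
  have hle : G.maxGenEigenspace 0 ≤
      LinearMap.ker A ⊓ (fixedSubalgebra θ).toSubmodule := by
    intro v hv
    rw [End.mem_maxGenEigenspace] at hv
    obtain ⟨k, hk⟩ := hv
    rw [zero_smul, sub_zero] at hk
    refine ⟨?_, ?_⟩
    · exact apply_eq_zero_of_pow_apply_eq_zero hss k
        (pow_apply_eq_zero_of_commute hGA (fun w hw => (hfix w hw).1) k v hk)
    · have h1 := pow_apply_eq_zero_of_commute hGΘ
        (fun w hw => by
          rw [LinearMap.sub_apply, (hfix w hw).2]; exact sub_self w) k v hk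
      have h2 := apply_eq_zero_of_pow_apply_eq_zero (A := Θ - 1) (fun w hw => by
        have h3 : θ (θ w - w) - (θ w - w) = 0 := hw
        rw [map_sub, hi] at h3
        have h4 : (2 : ℝ) • (θ w - w) = 0 := by
          rw [two_smul, ← neg_eq_zero, ← h3]; abel
        exact (smul_eq_zero.1 h4).resolve_left two_ne_zero) k h1
      exact sub_eq_zero.1 h2
  have hfin : finrank ℝ (LinearMap.ker A) ≤
      finrank ℝ (LinearMap.ker A ⊓ (fixedSubalgebra θ).toSubmodule : Submodule ℝ L) :=
    hmain.trans (Submodule.finrank_mono hle)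
  exact inf_eq_left.1 (Submodule.eq_of_le_of_finrank_le inf_le_left hfin)

end InnerImpliesRank

/-! ### Sign characters of root systems -/

/-- A sign character on a finite set of vectors which is closed under sums of pairs at an obtuse
angle is induced by a linear functional. The functional is prescribed on the simple vectors of a
positive system, which are linearly independent, and every positive vector is reached by adding
simple ones. -/
theorem exists_dual_exp_eq {E : Type*} [AddCommGroup E] [Module ℝ E]
    (S : LinearMap.BilinForm ℝ E) (hpos : ∀ x, x ≠ 0 → 0 < S x x)
    {R : Set E} (hfin : R.Finite) (h0 : (0 : E) ∉ R) (hneg : ∀ a ∈ R, -a ∈ R) (c : E → ℂ)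
    (hc : ∀ a ∈ R, c a = 1 ∨ c a = -1) (hcneg : ∀ a ∈ R, c (-a) = c a)
    (hadd : ∀ a ∈ R, ∀ b ∈ R, S a b < 0 → a + b ≠ 0 → a + b ∈ R ∧ c (a + b) = c a * c b) :
    ∃ f : Dual ℝ E, ∀ a ∈ R, Complex.exp (f a * (Real.pi * Complex.I)) = c a := by
  have : Finite R := hfin
  obtain ⟨l, hl⟩ := exists_dual_forall_apply_ne_zero (K := ℝ) (fun a : R => (a : E))
    (fun a ha => h0 (ha ▸ a.2))
  have hl : ∀ a ∈ R, l a ≠ 0 := fun a ha => hl ⟨a, ha⟩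
  -- If the difference of two roots at an acute angle is nonzero, it is a root.
  have hsub : ∀ a ∈ R, ∀ b ∈ R, 0 < S a b → a ≠ b → a - b ∈ R ∧ c (a - b) = c a * c b := by
    intro a ha b hb hab hne
    have := hadd a ha (-b) (hneg b hb) (by simpa using hab)
      (by rwa [← sub_eq_add_neg, sub_ne_zero])
    rwa [hcneg b hb, ← sub_eq_add_neg] at this
  have hlneg : ∀ a b, a - b ∈ R → ¬ 0 < l (a - b) → b - a ∈ R ∧ 0 < l (b - a) := by
    intro a b h1 h2
    have h3 := hneg _ h1
    rw [neg_sub] at h3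
    refine ⟨h3, ?_⟩
    have h4 := lt_of_le_of_ne (not_lt.1 h2) (hl _ h1)
    rw [← neg_sub, map_neg]
    linarith
  -- The positive vectors `P`, and the simple ones `Δ`.
  let P : Set E := {a | a ∈ R ∧ 0 < l a}
  let Δ : Set E := {a | a ∈ P ∧ ∀ b ∈ P, ∀ d ∈ P, a ≠ b + d}
  have hobt : ∀ a ∈ Δ, ∀ b ∈ Δ, a ≠ b → S a b ≤ 0 := by
    intro a ha b hb hne
    by_contra! hab
    obtain ⟨h1, -⟩ := hsub a ha.1.1 b hb.1.1 hab hne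
    by_cases h2 : 0 < l (a - b)
    · exact ha.2 b hb.1 (a - b) ⟨h1, h2⟩ (by abel)
    · exact hb.2 a ha.1 (b - a) (hlneg a b h1 h2) (by abel)
  have hli : LinearIndepOn ℝ id Δ :=
    S.linearIndependent_of_pairwise_le_zero (fun x hx => hpos x hx) l _ (fun a => a.2.1.2)
      (fun a b hab => hobt a a.2 b b.2 (fun h => hab (Subtype.ext h)))
  let bas := Basis.extend hli
  let f : Dual ℝ E := bas.constr ℝ fun a => if c a = 1 then (0 : ℝ) else 1
  have hf : ∀ a ∈ Δ, Complex.exp (f a * (Real.pi * Complex.I)) = c a := by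
    intro a ha
    have ha' : a ∈ hli.extend (Set.subset_univ _) := hli.subset_extend (Set.subset_univ _) ha
    have h1 : f a = if c a = 1 then (0 : ℝ) else 1 := by
      have := bas.constr_basis ℝ (fun a => if c a = 1 then (0 : ℝ) else 1) ⟨a, ha'⟩
      rwa [Basis.extend_apply_self] at this
    rcases hc a ha.1.1 with h | h
    · rw [h1, h]; simp
    · rw [h1, h, if_neg (by norm_num)]; simp [Complex.exp_pi_mul_I]
  -- Induction on the value of `l`.
  have hwf : WellFounded fun a b : R => l a < l b :=
    InvImage.wf (fun a : R => (⟨l a, a, rfl⟩ : Set.range fun a : R => l a))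
      (wellFounded_lt : WellFounded fun x y : Set.range fun a : R => l a => x < y)
  have hind : ∀ p : E → Prop, (∀ a ∈ P, (∀ b ∈ P, l b < l a → p b) → p a) → ∀ a ∈ P, p a := by
    intro p hp a ha
    have := hwf.induction (C := fun a : R => 0 < l a → p a) ⟨a, ha.1⟩ (fun x ih hx =>
      hp x ⟨x.2, hx⟩ fun b hb hbx => ih ⟨b, hb.1⟩ hbx hb.2)
    exact this ha.2
  -- Positive vectors are sums of simple ones.
  have hcone : ∀ a ∈ P, ∀ v, (∀ b ∈ Δ, S v b ≤ 0) → S v a ≤ 0 := by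
    refine hind _ fun a ha ih v hv => ?_
    by_cases haΔ : a ∈ Δ
    · exact hv a haΔ
    · have : ∃ b ∈ P, ∃ d ∈ P, a = b + d := by
        by_contra! h
        exact haΔ ⟨ha, h⟩
      obtain ⟨b, hb, d, hd, rfl⟩ := this
      have h1 := ih b hb (by rw [map_add]; linarith [hd.2]) v hv
      have h2 := ih d hd (by rw [map_add]; linarith [hb.2]) v hv
      rw [map_add]; linarith
  have hP : ∀ a ∈ P, Complex.exp (f a * (Real.pi * Complex.I)) = c a := by
    refine hind _ fun a ha ih => ?_
    by_cases haΔ : a ∈ Δ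
    · exact hf a haΔ
    · have : ∃ b ∈ Δ, 0 < S a b := by
        by_contra! h
        have h1 := hcone a ha a h
        have h2 := hpos a fun h => h0 (h ▸ ha.1)
        linarith
      obtain ⟨b, hb, hab⟩ := this
      obtain ⟨h1, h2⟩ := hsub a ha.1 b hb.1.1 hab fun h => haΔ (h ▸ hb)
      have h3 : 0 < l (a - b) := by
        by_contra h
        exact hb.2 a ha (b - a) (hlneg a b h1 h) (by abel)
      have h4 := ih (a - b) ⟨h1, h3⟩ (by rw [map_sub]; linarith [hb.1.2])
      have h5 : f a = f (a - b) + f b := by rw [map_sub]; ring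
      rw [h5, Complex.ofReal_add, add_mul, Complex.exp_add, h4, hf b hb, h2]
      rcases hc b hb.1.1 with h | h <;> rw [h] <;> ring
  refine ⟨f, fun a ha => ?_⟩
  by_cases h : 0 < l a
  · exact hP a ⟨ha, h⟩
  · have h1 : -a ∈ P := ⟨hneg a ha, by
      rw [map_neg]
      have := lt_of_le_of_ne (not_lt.1 h) (hl a ha)
      linarith⟩
    have h2 := hP _ h1
    rw [hcneg a ha, map_neg, Complex.ofReal_neg, neg_mul, Complex.exp_neg] at h2
    rw [← inv_inv (Complex.exp _), h2]
    rcases hc a ha with h | h <;> rw [h] <;> norm_num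

/-! ### Tori fixed by an involution -/

/-- A complex Lie algebra `V` with an inner product, the conjugation `σ` with respect to a compact
real form, an involution `Θ` commuting with `σ`, and a torus `j : E → V` in the compact real
form which is fixed by `Θ` and whose centralizer in `V` is its complex span. -/
structure IsTorusFixedBy {V E : Type*} [LieRing V] [LieAlgebra ℂ V] [AddCommGroup E] [Module ℝ E]
    (c : InnerProductSpace.Core ℂ V) (σ : V → V) (Θ : V →ₗ[ℂ] V) (j : E → V)
    (S : LinearMap.BilinForm ℝ E) : Prop where
  inner_lie_left : ∀ x y z, c.inner ⁅x, y⁆ z = -c.inner y ⁅σ x, z⁆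
  conj_conj : ∀ x, σ (σ x) = x
  conj_lie : ∀ x y, σ ⁅x, y⁆ = ⁅σ x, σ y⁆
  conj_smul : ∀ (a : ℂ) x, σ (a • x) = starRingEnd ℂ a • σ x
  inner_conj : ∀ x y, c.inner (σ x) (σ y) = c.inner y x
  theta_theta : ∀ x, Θ (Θ x) = x
  theta_lie : ∀ x y, Θ ⁅x, y⁆ = ⁅Θ x, Θ y⁆
  theta_conj : ∀ x, Θ (σ x) = σ (Θ x)
  conj_torus : ∀ H, σ (j H) = j H
  theta_torus : ∀ H, Θ (j H) = j H
  lie_torus : ∀ H H', ⁅j H, j H'⁆ = 0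
  torus_add : ∀ H H', j (H + H') = j H + j H'
  torus_smul : ∀ (r : ℝ) H, j (r • H) = (r : ℂ) • j H
  inner_torus : ∀ H H', c.inner (j H) (j H') = (S H H' : ℝ)
  form_symm : ∀ H H', S H H' = S H' H
  form_pos : ∀ H, H ≠ 0 → 0 < S H H
  centralizer : ∀ u, (∀ H, ⁅j H, u⁆ = 0) → ∃ A B, u = j A + Complex.I • j B

/-- The space of weight `H ↦ i S(α, H)` for a torus `j : E → V`. -/
def weightSpace {V E : Type*} [LieRing V] [LieAlgebra ℂ V] [AddCommGroup E] [Module ℝ E]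
    (j : E → V) (S : LinearMap.BilinForm ℝ E) (α : E) : Submodule ℂ V where
  carrier := {x | ∀ H, ⁅j H, x⁆ = (Complex.I * (S α H : ℝ)) • x}
  zero_mem' := fun H => by simp
  add_mem' := fun {x y} hx hy H => by rw [lie_add, hx H, hy H, smul_add]
  smul_mem' := fun a x hx H => by rw [lie_smul, hx H, smul_comm]

namespace IsTorusFixedBy

variable {V E : Type*} [LieRing V] [LieAlgebra ℂ V] [AddCommGroup E] [Module ℝ E]
  {c : InnerProductSpace.Core ℂ V} {σ : V → V} {Θ : V →ₗ[ℂ] V} {j : E → V}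
  {S : LinearMap.BilinForm ℝ E}

section Inner

variable (c : InnerProductSpace.Core ℂ V)

theorem _root_.InnerProductSpace.Core.inner_smul_right' (a : ℂ) (x y : V) :
    c.inner x (a • y) = a * c.inner x y := by
  rw [← c.conj_inner_symm, c.smul_left, map_mul, Complex.conj_conj, c.conj_inner_symm]

theorem _root_.InnerProductSpace.Core.inner_add_right' (x y z : V) :
    c.inner x (y + z) = c.inner x y + c.inner x z := by
  rw [← c.conj_inner_symm, c.add_left, map_add, c.conj_inner_symm, c.conj_inner_symm]

theorem _root_.InnerProductSpace.Core.inner_self_eq_re (x : V) :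
    c.inner x x = ((c.inner x x).re : ℂ) :=
  (Complex.conj_eq_iff_re.1 (c.conj_inner_symm x x)).symm

theorem _root_.InnerProductSpace.Core.inner_zero_re : (c.inner (0 : V) 0).re = 0 := by
  have := c.smul_left 0 0 (0 : ℂ)
  rw [zero_smul, map_zero, zero_mul] at this
  rw [this, Complex.zero_re]

theorem _root_.InnerProductSpace.Core.inner_self_re_pos {x : V} (hx : x ≠ 0) :
    0 < (c.inner x x).re := by
  refine lt_of_le_of_ne (c.re_inner_nonneg x) fun h => hx (c.definite x ?_)
  rw [c.inner_self_eq_re, ← h, Complex.ofReal_zero]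

end Inner

theorem lie_mem_weightSpace {α β : E} {x y : V} (hx : x ∈ weightSpace j S α)
    (hy : y ∈ weightSpace j S β) : ⁅x, y⁆ ∈ weightSpace j S (α + β) := fun H => by
  rw [leibniz_lie, hx H, hy H, smul_lie, lie_smul, ← add_smul, map_add,
    LinearMap.add_apply, Complex.ofReal_add, mul_add]

theorem theta_mem_weightSpace (h : IsTorusFixedBy c σ Θ j S)
    {α : E} {x : V} (hx : x ∈ weightSpace j S α) :
    Θ x ∈ weightSpace j S α := fun H => by
  rw [← map_smul, ← hx H, h.theta_lie, h.theta_torus]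

theorem conj_mem_weightSpace (h : IsTorusFixedBy c σ Θ j S)
    {α : E} {x : V} (hx : x ∈ weightSpace j S α) :
    σ x ∈ weightSpace j S (-α) := fun H => by
  conv_lhs => rw [← h.conj_torus, ← h.conj_lie, hx H, h.conj_smul]
  simp

theorem inner_lie_right (h : IsTorusFixedBy c σ Θ j S)
    (x y z : V) : c.inner y ⁅x, z⁆ = -c.inner ⁅σ x, y⁆ z := by
  rw [h.inner_lie_left, h.conj_conj, neg_neg]

theorem inner_eq_zero_of_mem_weightSpace (h : IsTorusFixedBy c σ Θ j S)
    {α β : E} (hαβ : α ≠ β) {x y : V}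
    (hx : x ∈ weightSpace j S α) (hy : y ∈ weightSpace j S β) : c.inner x y = 0 := by
  let H := α - β
  have h1 := h.inner_lie_left (j H) x y
  rw [h.conj_torus, hx H, hy H, c.smul_left, c.inner_smul_right'] at h1
  have h2 : (Complex.I * (S H H : ℝ)) * c.inner x y = 0 := by
    have e : S H H = S α H - S β H := by simp [H]
    rw [e, Complex.ofReal_sub]
    simp only [map_mul, Complex.conj_I, Complex.conj_ofReal] at h1
    linear_combination -h1
  have h3 : (Complex.I * (S H H : ℝ)) ≠ 0 := by
    have := (h.form_pos H (sub_ne_zero.2 hαβ)).ne'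
    simpa using this
  exact (mul_eq_zero.1 h2).resolve_left h3

/-- A vector centralized by the torus and orthogonal to it vanishes. -/
theorem eq_zero_of_mem_weightSpace_zero (h : IsTorusFixedBy c σ Θ j S)
    {u : V} (hu : u ∈ weightSpace j S 0)
    (ho : ∀ H, c.inner (j H) u = 0) : u = 0 := by
  obtain ⟨A, B, hAB⟩ := h.centralizer u fun H => by simpa using hu H
  apply c.definite
  have : c.inner (j A + Complex.I • j B) u = 0 := by
    rw [c.add_left, c.smul_left, ho, ho, mul_zero, add_zero]
  rwa [← hAB] at this

theorem torus_mem_weightSpace_zero (h : IsTorusFixedBy c σ Θ j S)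
    (H : E) : j H ∈ weightSpace j S 0 := fun H' => by
  rw [h.lie_torus]; simp

theorem inner_torus_lie_conj (h : IsTorusFixedBy c σ Θ j S)
    {α : E} {x y : V} (hx : x ∈ weightSpace j S α) (H : E) :
    c.inner (j H) ⁅x, σ y⁆ = Complex.I * (S α H : ℝ) * c.inner y x := by
  rw [h.inner_lie_right, ← lie_skew, h.conj_mem_weightSpace hx H, ← neg_smul, c.smul_left,
    h.inner_conj]
  simp

theorem lie_conj_mem_weightSpace_zero (h : IsTorusFixedBy c σ Θ j S)
    {α : E} {x y : V} (hx : x ∈ weightSpace j S α)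
    (hy : y ∈ weightSpace j S α) : ⁅x, σ y⁆ ∈ weightSpace j S 0 := by
  have := lie_mem_weightSpace hx (h.conj_mem_weightSpace hy)
  rwa [add_neg_cancel] at this

/-- The coroot relation `[x, σ x] = i |x|² α`. -/
theorem lie_conj_self (h : IsTorusFixedBy c σ Θ j S) {α : E} {x : V} (hx : x ∈ weightSpace j S α) :
    ⁅x, σ x⁆ = (Complex.I * c.inner x x) • j α := by
  rw [← sub_eq_zero]
  apply h.eq_zero_of_mem_weightSpace_zero
  · exact sub_mem (h.lie_conj_mem_weightSpace_zero hx hx)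
      (Submodule.smul_mem _ _ (h.torus_mem_weightSpace_zero α))
  · intro H
    rw [sub_eq_add_neg, ← neg_smul, c.inner_add_right', c.inner_smul_right',
      h.inner_torus_lie_conj hx, h.inner_torus, h.form_symm H α]
    ring

theorem lie_conj_eq_zero (h : IsTorusFixedBy c σ Θ j S)
    {α : E} {x y : V} (hx : x ∈ weightSpace j S α)
    (hy : y ∈ weightSpace j S α) (hxy : c.inner y x = 0) : ⁅x, σ y⁆ = 0 := by
  refine h.eq_zero_of_mem_weightSpace_zero (h.lie_conj_mem_weightSpace_zero hx hy) fun H => ?_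
  rw [h.inner_torus_lie_conj hx, hxy, mul_zero]

/-- The commutation relation of a raising and a lowering operator, in terms of norms. -/
theorem inner_lie_self (h : IsTorusFixedBy c σ Θ j S)
    {α β : E} {x y : V} (hx : x ∈ weightSpace j S α)
    (hy : y ∈ weightSpace j S β) :
    c.inner ⁅x, y⁆ ⁅x, y⁆ =
      c.inner ⁅σ x, y⁆ ⁅σ x, y⁆ - c.inner x x * c.inner y y * (S α β : ℝ) := by
  have h1 : ⁅σ x, ⁅x, y⁆⁆ = ((c.inner x x) * (S α β : ℝ)) • y + ⁅x, ⁅σ x, y⁆⁆ := by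
    rw [leibniz_lie, ← lie_skew (σ x) x, h.lie_conj_self hx, neg_lie, smul_lie, hy α, smul_smul,
      h.form_symm β α, ← neg_smul]
    congr 2
    linear_combination -(c.inner x x * (S α β : ℝ)) * Complex.I_mul_I
  rw [h.inner_lie_left, h1, c.inner_add_right', c.inner_smul_right', h.inner_lie_right]
  ring

theorem lie_ne_zero (h : IsTorusFixedBy c σ Θ j S)
    {α β : E} (hαβ : S α β < 0) {x y : V} (hx : x ∈ weightSpace j S α)
    (hy : y ∈ weightSpace j S β) (hx0 : x ≠ 0) (hy0 : y ≠ 0) : ⁅x, y⁆ ≠ 0 := by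
  intro h0
  have h1 := h.inner_lie_self hx hy
  rw [h0, c.inner_self_eq_re 0, c.inner_self_eq_re x, c.inner_self_eq_re y,
    c.inner_self_eq_re ⁅σ x, y⁆] at h1
  have h2 : (c.inner (0 : V) 0).re = (c.inner ⁅σ x, y⁆ ⁅σ x, y⁆).re -
    (c.inner x x).re * (c.inner y y).re * S α β := by exact_mod_cast h1
  have h3 : (c.inner (0 : V) 0).re = 0 := c.inner_zero_re
  have h4 : 0 ≤ (c.inner ⁅σ x, y⁆ ⁅σ x, y⁆).re := c.re_inner_nonneg _
  have h5 := mul_pos (c.inner_self_re_pos hx0) (c.inner_self_re_pos hy0)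
  nlinarith

/-- Root spaces are one-dimensional. -/
theorem exists_eq_smul (h : IsTorusFixedBy c σ Θ j S)
    {α : E} (hα : α ≠ 0) {x y : V} (hx : x ∈ weightSpace j S α)
    (hy : y ∈ weightSpace j S α) (hx0 : x ≠ 0) : ∃ a : ℂ, y = a • x := by
  have hort : ∀ z ∈ weightSpace j S α, c.inner x z = 0 → z = 0 := by
    intro z hz hxz
    by_contra hz0
    have h0 : ⁅σ x, z⁆ = 0 := by
      rw [← lie_skew, h.lie_conj_eq_zero hz hx hxz, neg_zero]
    have h2 := h.inner_lie_self hx hz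
    rw [h0, c.inner_self_eq_re 0, c.inner_self_eq_re x, c.inner_self_eq_re z,
      c.inner_self_eq_re ⁅x, z⁆] at h2
    have h3 : (c.inner ⁅x, z⁆ ⁅x, z⁆).re = (c.inner (0 : V) 0).re -
      (c.inner x x).re * (c.inner z z).re * S α α := by exact_mod_cast h2
    have h4 : (c.inner (0 : V) 0).re = 0 := c.inner_zero_re
    have h5 : 0 ≤ (c.inner ⁅x, z⁆ ⁅x, z⁆).re := c.re_inner_nonneg _
    have h6 := mul_pos (mul_pos (c.inner_self_re_pos hx0) (c.inner_self_re_pos hz0))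
      (h.form_pos α hα)
    linarith
  have hxx : c.inner x x ≠ 0 := fun h0 => hx0 (c.definite x h0)
  refine ⟨c.inner x y / c.inner x x, ?_⟩
  rw [← sub_eq_zero]
  refine hort _ (sub_mem hy (Submodule.smul_mem _ _ hx)) ?_
  rw [sub_eq_add_neg, ← neg_smul, c.inner_add_right', c.inner_smul_right']
  field_simp
  ring

/-- On a root space, `Θ` is a sign. -/
theorem theta_eq_or_eq_neg (h : IsTorusFixedBy c σ Θ j S)
    {α : E} (hα : α ≠ 0) {x : V} (hx : x ∈ weightSpace j S α) :
    Θ x = x ∨ Θ x = -x := by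
  by_cases hx0 : x = 0
  · left; rw [hx0, map_zero]
  obtain ⟨a, ha⟩ := h.exists_eq_smul hα hx (h.theta_mem_weightSpace hx) hx0
  have h1 := h.theta_theta x
  rw [ha, map_smul, ha, smul_smul] at h1
  have h2 : (a * a - 1) • x = 0 := by rw [sub_smul, h1, one_smul, sub_self]
  have h3 := (smul_eq_zero.1 h2).resolve_right hx0
  rcases mul_self_eq_one_iff.1 (sub_eq_zero.1 h3) with h4 | h4
  · left; rw [ha, h4, one_smul]
  · right; rw [ha, h4, neg_one_smul]

open Classical in
/-- The signs by which `Θ` acts on the root spaces, as a function of the root. -/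
theorem exists_sign (h : IsTorusFixedBy c σ Θ j S) : ∃ s : E → ℂ, (∀ α, s α = 1 ∨ s α = -1) ∧
    ∀ α, α ≠ 0 → ∀ x ∈ weightSpace j S α, Θ x = s α • x := by
  refine ⟨fun α => if ∃ x ∈ weightSpace j S α, x ≠ 0 ∧ Θ x = x then 1 else -1, fun α => ?_,
    fun α hα x hx => ?_⟩
  · beta_reduce
    split_ifs <;> simp
  · beta_reduce
    split_ifs with hex
    · obtain ⟨y, hy, hy0, hyΘ⟩ := hex
      obtain ⟨a, rfl⟩ := h.exists_eq_smul hα hy hx hy0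
      rw [map_smul, hyΘ, one_smul]
    · by_cases hx0 : x = 0
      · rw [hx0, map_zero, smul_zero]
      · rcases h.theta_eq_or_eq_neg hα hx with h1 | h1
        · exact absurd ⟨x, hx, hx0, h1⟩ hex
        · rw [h1, neg_one_smul]

theorem exists_form_eq [FiniteDimensional ℝ E]
    (h : IsTorusFixedBy c σ Θ j S) (f : Dual ℝ E) : ∃ α : E, ∀ H, S α H = f H := by
  have hinj : Function.Injective S := by
    rw [← LinearMap.ker_eq_bot, LinearMap.ker_eq_bot']
    intro α hα
    by_contra hne
    have := h.form_pos α hne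
    rw [hα] at this
    simp at this
  obtain ⟨α, hα⟩ := (LinearMap.injective_iff_surjective_of_finrank_eq_finrank
    Subspace.dual_finrank_eq.symm).1 hinj f
  exact ⟨α, fun H => by rw [hα]⟩

/-- The weight spaces span: the torus acts by commuting skew-Hermitian operators. -/
theorem iSup_weightSpace [FiniteDimensional ℝ E] [FiniteDimensional ℂ V]
    (h : IsTorusFixedBy c σ Θ j S) : ⨆ α, weightSpace j S α = ⊤ := by
  let := c.toNormedAddCommGroup
  let : InnerProductSpace ℂ V := InnerProductSpace.ofCore c.toCore
  have hin : ∀ u v : V, c.inner u v = inner ℂ u v := fun _ _ => rfl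
  let T : E → V →ₗ[ℂ] V := fun H => Complex.I • (LieAlgebra.ad ℂ V (j H) : V →ₗ[ℂ] V)
  have hT : ∀ H v, T H v = Complex.I • ⁅j H, v⁆ := fun _ _ => rfl
  have hsymm : ∀ H, (T H).IsSymmetric := fun H x y => by
    have h1 := h.inner_lie_left (j H) x y
    rw [h.conj_torus, hin, hin] at h1
    rw [hT, hT, inner_smul_left, inner_smul_right, h1]
    simp
  have hcomm : Pairwise (Function.onFun Commute T) := fun H H' _ => LinearMap.ext fun v => by
    change T H (T H' v) = T H' (T H v)
    rw [hT, hT, hT, hT, lie_smul, lie_smul, leibniz_lie (j H), h.lie_torus, zero_lie, zero_add]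
  rw [eq_top_iff, ← LinearMap.IsSymmetric.iSup_iInf_eq_top_of_commute hsymm hcomm]
  refine iSup_le fun χ v hv => ?_
  by_cases hv0 : v = 0
  · rw [hv0]; exact zero_mem _
  have hv : ∀ H, T H v = χ H • v := fun H =>
    End.mem_eigenspace_iff.1 ((Submodule.mem_iInf _).1 hv H)
  have hreal : ∀ H, ((χ H).re : ℂ) = χ H := fun H =>
    Complex.conj_eq_iff_re.1 ((hsymm H).conj_eigenvalue_eq_self
      (End.hasEigenvalue_of_hasEigenvector ⟨End.mem_eigenspace_iff.2 (hv H), hv0⟩))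
  have hlie : ∀ H, ⁅j H, v⁆ = (Complex.I * (-(χ H).re : ℝ)) • v := fun H => by
    have h1 := hv H
    rw [hT, ← hreal H] at h1
    have h2 := congrArg (fun w => -Complex.I • w) h1
    simp only [smul_smul, neg_mul, Complex.I_mul_I, neg_neg, one_smul] at h2
    rw [h2]; simp
  let f : Dual ℝ E :=
    { toFun := fun H => -(χ H).re
      map_add' := fun H H' => by
        have h1 := hlie (H + H')
        rw [h.torus_add, add_lie, hlie, hlie, ← add_smul] at h1
        have h2 := smul_left_injective ℂ hv0 h1
        rw [← mul_add] at h2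
        have h3 := mul_left_cancel₀ Complex.I_ne_zero h2
        exact_mod_cast h3.symm
      map_smul' := fun r H => by
        have h1 := hlie (r • H)
        rw [h.torus_smul, smul_lie, hlie, smul_smul, mul_left_comm] at h1
        have h2 := smul_left_injective ℂ hv0 h1
        have h3 := mul_left_cancel₀ Complex.I_ne_zero h2
        rw [RingHom.id_apply, smul_eq_mul]
        exact_mod_cast h3.symm }
  obtain ⟨α, hα⟩ := h.exists_form_eq f
  exact Submodule.mem_iSup_of_mem α fun H => by rw [hα, hlie]; rfl

/-- There are finitely many roots, as root vectors are linearly independent. -/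
theorem finite_setOf_exists_mem_weightSpace [FiniteDimensional ℂ V]
    (h : IsTorusFixedBy c σ Θ j S) :
    {α : E | α ≠ 0 ∧ ∃ x ∈ weightSpace j S α, x ≠ 0}.Finite := by
  let := c.toNormedAddCommGroup
  let : InnerProductSpace ℂ V := InnerProductSpace.ofCore c.toCore
  let R : Set E := {α : E | α ≠ 0 ∧ ∃ x ∈ weightSpace j S α, x ≠ 0}
  choose x hx hx0 using fun α : R => α.2.2
  have hli : LinearIndependent ℂ x := linearIndependent_of_ne_zero_of_inner_eq_zero hx0
    fun α β hαβ => h.inner_eq_zero_of_mem_weightSpace (fun he => hαβ (Subtype.ext he)) (hx α) (hx β)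
  exact hli.finite

/-- An involution fixing a self-centralizing torus is the exponential of an element of this
torus. -/
theorem exists_eq_expEnd [FiniteDimensional ℝ E] [FiniteDimensional ℂ V]
    (h : IsTorusFixedBy c σ Θ j S) : ∃ z : V, Θ = expEnd ℂ (LieAlgebra.ad ℂ V z) := by
  obtain ⟨s, hs1, hs⟩ := h.exists_sign
  have hsx : ∀ α, α ≠ 0 → ∀ x ∈ weightSpace j S α, x ≠ 0 → ∀ a : ℂ, Θ x = a • x → s α = a := by
    intro α hα x hx hx0 a ha
    rw [hs α hα x hx] at ha
    exact smul_left_injective ℂ hx0 ha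
  have hσ0 : ∀ x, x ≠ 0 → σ x ≠ 0 := fun x hx0 h0 => hx0 (by
    rw [← h.conj_conj x, h0]
    simpa using h.conj_smul 0 0)
  obtain ⟨f, hf⟩ := exists_dual_exp_eq S h.form_pos h.finite_setOf_exists_mem_weightSpace
    (fun h0 => h0.1 rfl)
    (fun α ⟨hα, x, hx, hx0⟩ => ⟨neg_ne_zero.2 hα, σ x, h.conj_mem_weightSpace hx, hσ0 x hx0⟩)
    s (fun α _ => hs1 α)
    (fun α ⟨hα, x, hx, hx0⟩ => hsx _ (neg_ne_zero.2 hα) (σ x) (h.conj_mem_weightSpace hx)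
      (hσ0 x hx0) _ (by
        rw [h.theta_conj, hs α hα x hx, h.conj_smul]
        rcases hs1 α with h1 | h1 <;> simp [h1]))
    (fun α ⟨hα, x, hx, hx0⟩ β ⟨hβ, y, hy, hy0⟩ hαβ hne => by
      have h1 := h.lie_ne_zero hαβ hx hy hx0 hy0
      have h2 := lie_mem_weightSpace hx hy
      refine ⟨⟨hne, _, h2, h1⟩, hsx _ hne _ h2 h1 _ ?_⟩
      rw [h.theta_lie, hs α hα x hx, hs β hβ y hy, smul_lie, lie_smul, smul_smul])
  obtain ⟨Z, hZ⟩ := h.exists_form_eq f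
  refine ⟨(Real.pi : ℂ) • j Z, ?_⟩
  let F : V →ₗ[ℂ] V := Θ - expEnd ℂ (LieAlgebra.ad ℂ V ((Real.pi : ℂ) • j Z))
  have htop : LinearMap.ker F = ⊤ := by
    rw [eq_top_iff, ← h.iSup_weightSpace]
    refine iSup_le fun α x hx => ?_
    rw [LinearMap.mem_ker, LinearMap.sub_apply, sub_eq_zero]
    have had : LieAlgebra.ad ℂ V ((Real.pi : ℂ) • j Z) x =
        (f α * (Real.pi * Complex.I) : ℂ) • x := by
      rw [LieAlgebra.ad_apply, smul_lie, hx Z, smul_smul, h.form_symm, hZ]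
      congr 1; ring
    rw [expEnd_apply_of_eq_smul had, ← Complex.exp_eq_exp_ℂ]
    by_cases hα : α = 0
    · obtain ⟨A, B, rfl⟩ := h.centralizer x fun H => by
        have := hx H
        rw [hα] at this
        simpa using this
      rw [map_add, map_smul, h.theta_torus, h.theta_torus, hα]
      simp
    · by_cases hx0 : x = 0
      · rw [hx0, map_zero, smul_zero]
      · rw [hf α ⟨hα, x, hx, hx0⟩, hs α hα x hx]
  exact sub_eq_zero.1 (LinearMap.ker_eq_top.1 htop)

end IsTorusFixedBy

/-! ### Inner involutions and compact Cartan subalgebras -/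

section Main

variable {L : Type*} [LieRing L] [LieAlgebra ℝ L] {θ : L ≃ₗ⁅ℝ⁆ L} {S : LinearMap.BilinForm ℝ L}

/-- If the centralizer of `X` is abelian and lies in `𝔨`, it is a torus of the complexification
fixed by `θ`. -/
theorem IsCartanForm.isTorusFixedBy (hS : IsCartanForm θ S) (hi : ∀ x, θ (θ x) = x) {X : L}
    (hab : ∀ u v : L, ⁅X, u⁆ = 0 → ⁅X, v⁆ = 0 → ⁅u, v⁆ = 0)
    (hk : LinearMap.ker (LieAlgebra.ad ℝ L X) ≤ (fixedSubalgebra θ).toSubmodule) :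
    IsTorusFixedBy hS.hermitianCore (compactConj θ) (θ.toLinearEquiv.toLinearMap.baseChange ℂ)
      (fun H : LinearMap.ker (LieAlgebra.ad ℝ L X) => (1 : ℂ) ⊗ₜ[ℝ] (H : L))
      (S.restrict (LinearMap.ker (LieAlgebra.ad ℝ L X))) := by
  have hfix : ∀ H : LinearMap.ker (LieAlgebra.ad ℝ L X), θ H = H := fun H => hk H.2
  have hc : ∀ u : L, ⁅X, u⁆ = 0 → u ∈ LinearMap.ker (LieAlgebra.ad ℝ L X) := fun u hu => hu
  have hΘ : ∀ x, θ.toLinearEquiv.toLinearMap x = θ x := fun _ => rfl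
  exact
  { inner_lie_left := hS.hermitianExtension_lie
    conj_conj := fun x => complexification_ext (by simp [hi]) (by simp [hi])
    conj_lie := fun x y => complexification_ext (by simp [LieEquiv.map_lie]) (by
      simp only [imPart_compactConj, imPart_lie, rePart_compactConj, map_add, LieEquiv.map_lie,
        lie_neg, neg_lie]
      abel)
    conj_smul := fun a x => complexification_ext (by simp) (by simp; abel)
    inner_conj := fun x y => by
      change hermitianExtension S _ _ = hermitianExtension S _ _
      apply Complex.ext
      · simp [hermitianExtension, hS.map_map, hS.symm (rePart x), hS.symm (imPart x)]
      · simp [hermitianExtension, hS.map_map, hS.symm (rePart x), hS.symm (imPart x)]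
        ring
    theta_theta := fun x => complexification_ext (by simp [hΘ, hi]) (by simp [hΘ, hi])
    theta_lie := fun x y =>
      complexification_ext (by simp [hΘ, LieEquiv.map_lie]) (by simp [hΘ, LieEquiv.map_lie])
    theta_conj := fun x => complexification_ext (by simp [hΘ]) (by simp [hΘ])
    conj_torus := fun H => complexification_ext (by simp [hfix]) (by simp)
    theta_torus := fun H => complexification_ext (by simp [hΘ, hfix]) (by simp)
    lie_torus := fun H H' =>
      complexification_ext (by simp [hab H H' H.2 H'.2]) (by simp)
    torus_add := fun H H' => TensorProduct.tmul_add _ _ _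
    torus_smul := fun r H =>
      complexification_ext (by rw [rePart_smul]; simp) (by rw [imPart_smul]; simp)
    inner_torus := fun H H' => by
      change hermitianExtension S _ _ = _
      apply Complex.ext <;> simp [hermitianExtension]
    form_symm := fun H H' => hS.symm _ _
    form_pos := fun H hH => hS.pos _ fun h0 => hH (Subtype.ext h0)
    centralizer := fun u hu => by
      have h0 := hu ⟨X, hc X (lie_self X)⟩
      have hre := congrArg rePart h0
      have him := congrArg imPart h0
      simp at hre him
      refine ⟨⟨rePart u, hc _ hre⟩, ⟨imPart u, hc _ him⟩, ?_⟩
      exact complexification_ext (by simp) (by simp) }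

variable [FiniteDimensional ℝ L]

/-- If the abelian centralizer of `X` lies in `𝔨`, then `θ` is the exponential of an element of the
complexified torus, and so inner. -/
theorem IsCartanForm.isInnerOnComplexification_of_centralizer_le (hS : IsCartanForm θ S)
    (hi : ∀ x, θ (θ x) = x) {X : L} (hab : ∀ u v : L, ⁅X, u⁆ = 0 → ⁅X, v⁆ = 0 → ⁅u, v⁆ = 0)
    (hk : LinearMap.ker (LieAlgebra.ad ℝ L X) ≤ (fixedSubalgebra θ).toSubmodule) :
    IsInnerOnComplexification θ := by
  obtain ⟨z, hz⟩ := (hS.isTorusFixedBy hi hab hk).exists_eq_expEnd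
  exact Subgroup.subset_closure ⟨z, hz⟩

end Main

end ReductiveLie

end

theorem mainTheorem7 {L : Type*} [LieRing L] [LieAlgebra ℝ L] [FiniteDimensional ℝ L]
    (θ : L ≃ₗ⁅ℝ⁆ L) (hθ : ReductiveLie.IsCartanInvolution θ) :
    (ReductiveLie.IsInnerOnComplexification θ ↔
      ReductiveLie.HasMaximalRank (ReductiveLie.fixedSubalgebra θ)) ∧
    (ReductiveLie.IsInnerOnComplexification θ →
      ∃ h : LieSubalgebra ℝ L, ReductiveLie.IsCompactCartanSubalgebra θ h) := by
  obtain ⟨S, hS⟩ := hθ.exists_isCartanForm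
  have hi := hθ.involutive
  obtain ⟨X, hX, hab⟩ := hS.exists_abelian_centralizer hi
  rw [hS.hasMaximalRank_iff hX hab]
  exact ⟨⟨hS.centralizer_le_of_isInnerOnComplexification hi hX hab,
    hS.isInnerOnComplexification_of_centralizer_le hi hab⟩,
    fun h => hS.exists_isCompactCartanSubalgebra hX hab
      (hS.centralizer_le_of_isInnerOnComplexification hi hX hab h)⟩
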